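/- Let $n\ge 2$ be an integer. **The lattice $\mathcal Z(n)$.** Let $\mathcal Z(n)$ be the set of integer sequences $s=(s_1,\dots,s_n)$ with $n\ge s_1\ge\cdots\ge s_n\ge 0$ and $s_i>s_{i+1}$ whenever $i<n$ and $s_i\ne 0$, ordered componentwise. If $t$ covers $s$, then $t$ and $s$ differ in one position $k$, where $t_k=s_k+1$, and the covering edge $s\to t$ is given the color $n+1-t_k$. **The Mixedmiddleswitch digraph $\mathcal B(n)$.** Its vertices are the binary sequences of length $n$. For $1\le i\le n$ there is an edge $s\xrightarrow{i}t$ if and only if $s_j=t_j$ for all $j\neq i$ and one of the following holds: $1<i<n$ and $(s_{i-1},s_i,s_{i+1})\to(t_{i-1},t_i,t_{i+1})$ is $(0,0,1)\to(0,1,1)$ or $(1,1,0)\to(1,0,0)$; $i=1$ and $(s_1,s_2)\to(t_1,t_2)$ is $(0,1)\to(1,1)$; $i=n$ and $(s_{n-1},s_n)\to(t_{n-1},t_n)$ is $(0,0)\to(0,1)$ or $(1,1)\to(1,0)$. **Type $\mathsf B_n$ data.** Let $(a_{ij})$ be the Cartan matrix of type $\mathsf B_n$, $a_{ij}=\langle\alpha_i,\alpha_j^\vee\rangle$,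 $\alpha^\vee=2\alpha/\langle\alpha,\alpha\rangle$, with simple roots numbered so that $\alpha_n$ is short (so $a_{n-1,n}=-2$, $a_{n,n-1}=-1$). Let $\omega_1,\dots,\omega_n$ be the fundamental weights, $\Lambda=\bigoplus_i\mathbb Z\omega_i$, so $\alpha_i=\sum_j a_{ij}\omega_j$, and let $\varrho=\sum_i\omega_i$. The Weyl group $W$ is generated by the reflections $s_i\colon\mu\mapsto\mu-\langle\mu,\alpha_i^\vee\rangle\alpha_i$ of $\Lambda$. In the group ring $\mathbb Z[\Lambda]$, with basis $\{\mathsf z^\mu\}_{\mu\in\Lambda}$, put $\mathcal A(\mathsf z^\mu)=\sum_{\sigma\in W}\det(\sigma)\,\mathsf z^{\sigma\mu}$. For dominant $\lambda$, the Weyl bialternant $\chi_\lambda^{\mathsf B_n}$ is the unique $\chi\in\mathbb Z[\Lambda]$ with $\mathcal A(\mathsf z^{\varrho})\,\chi=\mathcal A(\mathsf z^{\lambda+\varrho})$. **Colored posets.** A rank function on a finite poset is a surjection $\rho$ onto some $\{0,\dots,l\}$ that increases by exactly $1$ along each covering relation; its rank generating function is $\sum_x q^{\rho(x)}$. Consider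 a finite ranked poset $R$ whose order diagram has its edges colored by $\{1,\dots,n\}$. Each $i$-component of $R$ (connected component of the graph of color-$i$ edges) has a unique rank function. Let $\rho_i(x)$ be the rank of $x$ in its $i$-component, let $l_i(x)$ be the length of this component, and put $\delta_i(x)=l_i(x)-\rho_i(x)$ and $\mathrm{wt}(x)=\sum_i(\rho_i(x)-\delta_i(x))\omega_i$. The weight-generating function of $R$ is $\sum_{x\in R}\mathsf z^{\mathrm{wt}(x)}$. $R$ is $\mathsf B_n$-structured if $\mathrm{wt}(s)+\alpha_i=\mathrm{wt}(t)$ for every edge $s\xrightarrow{i}t$. A $\mathsf B_n$-structured $R$ is a splitting poset for $\chi\in\mathbb Z[\Lambda]$ if its weight-generating function is $\chi$. A distributive lattice with colored edges is diamond-colored if, whenever $v\xrightarrow{k}s\xrightarrow{i}u$ and $v\xrightarrow{l}t\xrightarrow{j}u$ are edges with $s\ne t$, we have $i=l$ and $j=k$. **Proposition.** With its edge coloring, $\mathcal Z(n)$ is a diamond-colored distributive lattice and a splitting poset for $\chi_{\omega_n}^{\mathsf B_n}$; that is, it is ranked and $\mathsf B_n$-structured and its weight-generating function equals $\chi_{\omega_n}^{\mathsf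 B_n}$. Its rank generating function is $\prod_{i=1}^n(1+q^i)$, and the coefficient sequence of this polynomial is symmetric and unimodal. Moreover, there is a partial order on the set of binary sequences of length $n$ whose edge-colored order diagram is exactly $\mathcal B(n)$ and which makes it a diamond-colored distributive lattice and a splitting poset for $\chi_{\omega_n}^{\mathsf B_n}$. -/

import Mathlib

open Polynomial

namespace SplittingPosets

section ColoredDigraphs

variable {V I : Type*}

/-! An edge-colored directed graph with vertex set `V` and color set `I` is given by its
relation `E : V → I → V → Prop`, where `E s i t` says that there is an edge of color `i`
from `s` to `t`. -/

/-- The partial order on `V` has `E` as its edge-colored order diagram: the colored edges are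
exactly the covering relations, and each covering relation carries exactly one color. -/
def IsOrderDiagram [PartialOrder V] (E : V → I → V → Prop) : Prop :=
  (∀ s i t, E s i t → s ⋖ t) ∧ ∀ s t, s ⋖ t → ∃! i, E s i t

/-- In every diamond of the digraph, opposite edges have the same color. -/
def IsDiamondColored (E : V → I → V → Prop) : Prop :=
  ∀ (v s t u : V) (i j k l : I), s ≠ t →
    E v k s → E v l t → E s i u → E t j u → i = l ∧ j = k

/-- The given partial order is the order of a distributive lattice. -/
def IsDistributiveLatticeOrder (V : Type*) [P : PartialOrder V] : Prop :=
  ∃ L : DistribLattice V, ∀ a b : V, L.le a b ↔ P.le a b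

/-- On the set `C` of vertices of the digraph `E`, the function `ρ` is a rank function of
length `l`: it maps `C` onto `{0, …, l}` and goes up by one along each edge inside `C`. -/
def IsRankFunctionOn (E : V → V → Prop) (C : Set V) (ρ : V → ℕ) (l : ℕ) : Prop :=
  ρ '' C = Set.Iic l ∧ ∀ s ∈ C, ∀ t ∈ C, E s t → ρ s + 1 = ρ t

/-- A rank function of length `l` on a poset. -/
def IsRankFunction [PartialOrder V] (ρ : V → ℕ) (l : ℕ) : Prop :=
  IsRankFunctionOn (fun s t : V => s ⋖ t) Set.univ ρ l

/-- The rank generating function `∑ q ^ ρ x` of a rank function `ρ`. -/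
noncomputable def rankGenFun [Fintype V] (ρ : V → ℕ) : ℤ[X] :=
  ∑ x, X ^ ρ x

/-- The `i`-component of `x`: all vertices joined to `x` by a path (with edges traversed in
either direction) all of whose edges have color `i`. -/
def component (E : V → I → V → Prop) (i : I) (x : V) : Set V :=
  {y | Relation.EqvGen (fun s t => E s i t) x y}

/-- The rank function of the `i`-component of `x`, with the length of that component. Both
are determined on the component, which is connected, as soon as the component is ranked;
this is the case whenever the digraph is the order diagram of a finite ranked poset. -/
noncomputable def componentRank (E : V → I → V → Prop) (i : I) (x : V) : (V → ℕ) × ℕ :=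
  Classical.epsilon fun p =>
    IsRankFunctionOn (fun s t => E s i t) (component E i x) p.1 p.2

/-- `ρ_i(x)`: the rank of `x` within its `i`-component. -/
noncomputable def colorRank (E : V → I → V → Prop) (i : I) (x : V) : ℕ :=
  (componentRank E i x).1 x

/-- `δ_i(x) = l_i(x) - ρ_i(x)`: the depth of `x` within its `i`-component. -/
noncomputable def colorDepth (E : V → I → V → Prop) (i : I) (x : V) : ℤ :=
  ((componentRank E i x).2 : ℤ) - colorRank E i x

/-- The combinatorial weight `∑ i, (ρ_i(x) - δ_i(x)) ω_i` of `x`, in the coordinates of the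
weight lattice with respect to the fundamental weights `ω_i`. -/
noncomputable def posetWt (E : V → I → V → Prop) (x : V) : I → ℤ :=
  fun i => (colorRank E i x : ℤ) - colorDepth E i x

/-- The weight-generating function `∑ z ^ posetWt x`, an element of the group ring of the
weight lattice. -/
noncomputable def weightGenFun [Fintype V] (E : V → I → V → Prop) :
    AddMonoidAlgebra ℤ (I → ℤ) :=
  ∑ x, AddMonoidAlgebra.single (posetWt E x) 1

end ColoredDigraphs

section WeylGroups

/-! The root system enters through its Cartan matrix `A`, `A i j = ⟨α_i, α_j^∨⟩`. The weight
lattice is `I → ℤ`, where `m : I → ℤ` stands for `∑ i, m i • ω_i`; so `⟨m, α_i^∨⟩ = m i`. -/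

variable {I : Type*}

/-- `α_i = ∑ j, ⟨α_i, α_j^∨⟩ ω_j`. -/
def simpleRoot (A : Matrix I I ℤ) (i : I) : I → ℤ := fun j => A i j

/-- The fundamental weight `ω_i`. -/
def fundamentalWeight [DecidableEq I] (i : I) : I → ℤ := Pi.single i 1

/-- `ϱ = ∑ i, ω_i`. -/
def weylVector (I : Type*) : I → ℤ := fun _ => 1

/-- The Weyl group, acting on the weight lattice: it is generated by the simple reflections
`s_i : μ ↦ μ - ⟨μ, α_i^∨⟩ α_i`. -/
def weylGroup (A : Matrix I I ℤ) : Subgroup ((I → ℤ) ≃ₗ[ℤ] (I → ℤ)) :=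
  Subgroup.closure {s | ∃ i, ∀ μ, s μ = μ - μ i • simpleRoot A i}

/-- `𝒜(φ) = ∑ σ ∈ W, det(σ) σ.φ`, where `σ.e^μ = e^(σ μ)`. (The Weyl group of a finite root
system is finite.) -/
noncomputable def alternant (A : Matrix I I ℤ) (φ : AddMonoidAlgebra ℤ (I → ℤ)) :
    AddMonoidAlgebra ℤ (I → ℤ) :=
  ∑ᶠ σ : weylGroup A,
    LinearMap.det ((σ : (I → ℤ) ≃ₗ[ℤ] (I → ℤ)) : (I → ℤ) →ₗ[ℤ] (I → ℤ)) •
      AddMonoidAlgebra.mapDomain (σ : (I → ℤ) ≃ₗ[ℤ] (I → ℤ)) φ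

/-- `χ` is the Weyl bialternant of highest weight `lam`: the unique element of the group ring
with `𝒜(e^ϱ) χ = 𝒜(e^(lam + ϱ))`. -/
def IsWeylBialternant (A : Matrix I I ℤ) (lam : I → ℤ) (χ : AddMonoidAlgebra ℤ (I → ℤ)) :
    Prop :=
  (alternant A (AddMonoidAlgebra.single (weylVector I) 1) * χ =
      alternant A (AddMonoidAlgebra.single (lam + weylVector I) 1)) ∧
    ∀ χ' : AddMonoidAlgebra ℤ (I → ℤ),
      alternant A (AddMonoidAlgebra.single (weylVector I) 1) * χ' =
        alternant A (AddMonoidAlgebra.single (lam + weylVector I) 1) → χ' = χ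

end WeylGroups

section SplittingLattices

variable {V I : Type*}

/-- The digraph is `Φ`-structured, for the root system `Φ` with Cartan matrix `A`. -/
def IsStructured (A : Matrix I I ℤ) (E : V → I → V → Prop) : Prop :=
  ∀ s i t, E s i t → posetWt E s + simpleRoot A i = posetWt E t

/-- The finite poset `V`, with edge-colored order diagram `E`, is a diamond-colored
distributive lattice, and it is a splitting poset for `χ` with respect to the root system with
Cartan matrix `A`: it is ranked and structured, with weight-generating function `χ`. -/
structure IsDiamondColoredSplittingDistributiveLattice [Fintype V] [PartialOrder V]
    (A : Matrix I I ℤ) (E : V → I → V → Prop) (χ : AddMonoidAlgebra ℤ (I → ℤ)) : Prop where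
  orderDiagram : IsOrderDiagram E
  distributive : IsDistributiveLatticeOrder V
  diamondColored : IsDiamondColored E
  ranked : ∃ (ρ : V → ℕ) (l : ℕ), IsRankFunction ρ l
  structured : IsStructured A E
  weightGenFun_eq : weightGenFun E = χ

end SplittingLattices

/-- The coefficients of the polynomial read the same in both directions. -/
def IsSymmetricPoly (p : ℤ[X]) : Prop :=
  ∀ k ≤ p.natDegree, p.coeff k = p.coeff (p.natDegree - k)

/-- The coefficients of the polynomial weakly increase and then weakly decrease. -/
def IsUnimodalPoly (p : ℤ[X]) : Prop :=
  ∃ m, MonotoneOn p.coeff (Set.Iic m) ∧ AntitoneOn p.coeff (Set.Ici m)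

/-! Positions and colors `1, …, n` are represented by `Fin n`: the element `i : Fin n` stands
for position or color `i + 1`. -/

/-- `𝒵(n)`: the zero-cushioned `[1,n]`-subsets, i.e. the integer sequences
`n ≥ s_1 ≥ ⋯ ≥ s_n ≥ 0` with `s_i > s_{i+1}` whenever `s_i ≠ 0`. As a subtype of `Fin n → ℕ`
it is ordered componentwise. -/
abbrev ZeroCushioned (n : ℕ) : Type :=
  {s : Fin n → ℕ // (∀ i, s i ≤ n) ∧ Antitone s ∧
    ∀ i j : Fin n, (i : ℕ) + 1 = j → s i ≠ 0 → s j < s i}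

instance (n : ℕ) : Finite (ZeroCushioned n) :=
  Finite.of_injective
    (fun s : ZeroCushioned n => fun i => (⟨s.1 i, Nat.lt_succ_of_le (s.2.1 i)⟩ : Fin (n + 1)))
    (fun _ _ h => Subtype.ext (funext fun i => congrArg Fin.val (congrFun h i)))

noncomputable instance (n : ℕ) : Fintype (ZeroCushioned n) := Fintype.ofFinite _

/-- The colored edges of `𝒵(n)`: if `t` covers `s`, and `k` is the position in which they
differ, with `t_k = s_k + 1`, then the edge has color `n + 1 - t_k`. -/
def zeroCushionedEdge (n : ℕ) (s : ZeroCushioned n) (i : Fin n) (t : ZeroCushioned n) : Prop :=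
  s ⋖ t ∧ ∃ k : Fin n, t.1 k = s.1 k + 1 ∧ (∀ j, j ≠ k → t.1 j = s.1 j) ∧
    ((i : ℕ) + 1 : ℤ) = n + 1 - t.1 k

/-- `ℬ(n)`: the binary sequences of length `n`. -/
def BinarySeq (n : ℕ) : Type := Fin n → Fin 2

instance (n : ℕ) : Fintype (BinarySeq n) := inferInstanceAs (Fintype (Fin n → Fin 2))

/-- The colored edges of the Mixedmiddleswitch puzzle digraph: `a`, `i`, `b` are consecutive
positions, and the five cases are `(0,0,1) → (0,1,1)` and `(1,1,0) → (1,0,0)` in the middle,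
`(0,1) → (1,1)` at the left end, and `(0,0) → (0,1)` and `(1,1) → (1,0)` at the right end. -/
def mixedMiddleSwitchEdge (n : ℕ) (s : BinarySeq n) (i : Fin n) (t : BinarySeq n) : Prop :=
  (∀ j, j ≠ i → s j = t j) ∧
    ((∃ a b : Fin n, (a : ℕ) + 1 = i ∧ (i : ℕ) + 1 = b ∧
        (s a, s i, s b) = (0, 0, 1) ∧ (t a, t i, t b) = (0, 1, 1)) ∨
      (∃ a b : Fin n, (a : ℕ) + 1 = i ∧ (i : ℕ) + 1 = b ∧
        (s a, s i, s b) = (1, 1, 0) ∧ (t a, t i, t b) = (1, 0, 0)) ∨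
      ((i : ℕ) = 0 ∧ ∃ b : Fin n, (i : ℕ) + 1 = b ∧
        (s i, s b) = (0, 1) ∧ (t i, t b) = (1, 1)) ∨
      ((i : ℕ) + 1 = n ∧ ∃ a : Fin n, (a : ℕ) + 1 = i ∧
        (s a, s i) = (0, 0) ∧ (t a, t i) = (0, 1)) ∨
      ((i : ℕ) + 1 = n ∧ ∃ a : Fin n, (a : ℕ) + 1 = i ∧
        (s a, s i) = (1, 1) ∧ (t a, t i) = (1, 0)))

end SplittingPosets

open SplittingPosets

/-! Both digraphs are disguises of the crystal of the spin representation, whose weights in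
orthogonal coordinates are the vectors `(±1/2, …, ±1/2)`. Record such a weight as a word of bits;
adding `α_i` moves a one from position `i + 1` to position `i`, and adding `α_n` turns the last zero
into a one. A sequence in `𝒵(n)` is encoded by the set of its nonzero values, with position `i`,
counted from `0`, standing for the value `n - i`. A binary sequence in `ℬ(n)` is encoded by the
places where consecutive letters change, after a `0` is put in front. Under both encodings the
colored edges become `spinEdge`, so `ℬ(n)` inherits the order of `𝒵(n)`, and everything that depends
on the colored digraph alone is proved once, for words.

In each color every vertex lies on at most one edge. Components therefore have one or two vertices,
and the combinatorial weight is the true weight (`IsSpinIso.posetWt_eq`).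

The weight generating function is the bialternant because the representation is minuscule. The set
of weights is invariant under `W`, so multiplying an alternant by their sum gives the sum of the
shifted alternants (`alternant_mul_spinCharacter`). Each weight except the highest has some
coordinate `-1`, which makes its sum with `ϱ` fixed by a simple reflection and kills its alternant
(`alternant_single_eq_zero`). Uniqueness is cancellation of the nonzero factor `𝒜(e^ϱ)`.

The rank of a word is a sum of independent contributions of its bits, which gives the product
formula; complementing the bits gives symmetry. Unimodality comes from the principal `𝔰𝔩₂`: a
weighted sum `E` of the raising operators satisfies `[E, Eᵀ] = 2 rank - length`, and positivity of
the inner product makes `E` injective on every level below the middle (`levelCard_le_succ`). -/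

namespace SplittingPosets

/-! ### The digraph of spin weights -/

section SpinWords

/-- The vertices of the spin digraph: the weights of the spin representation, written as the
words of signs of their coordinates. -/
abbrev SpinWord (n : ℕ) : Type := Fin n → Bool

variable {n : ℕ}

/-- The letters of a word as numbers; positions past the end count as `0`. -/
def bit (t : SpinWord n) (j : ℕ) : ℕ := if h : j < n then (t ⟨j, h⟩).toNat else 0

/-- The number of ones of a word up to position `j`, inclusive. -/
def height (t : SpinWord n) (j : ℕ) : ℕ := ∑ i ∈ Finset.range (j + 1), bit t i

/-- Toggle the letter at position `i`, and the next one if there is one. -/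
def toggle (i : Fin n) (t : SpinWord n) : SpinWord n :=
  fun j => if j = i ∨ (j : ℕ) = i + 1 then !t j else t j

/-- The colored edges of the spin digraph: `(0, 1) → (1, 0)` at positions `i`, `i + 1`, or
`0 → 1` at the last position. -/
def spinEdge (s : SpinWord n) (i : Fin n) (t : SpinWord n) : Prop :=
  s i = false ∧ (∀ j : Fin n, (j : ℕ) = i + 1 → s j = true) ∧ t = toggle i s

/-- The weight of a word, in the coordinates with respect to the fundamental weights. -/
def spinWt (t : SpinWord n) (i : Fin n) : ℤ :=
  if (i : ℕ) + 1 < n then (bit t i : ℤ) - bit t (i + 1) else 2 * bit t i - 1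

theorem bit_coe (t : SpinWord n) (i : Fin n) : bit t i = (t i).toNat := by
  simp [bit]

theorem bit_le_one (t : SpinWord n) (j : ℕ) : bit t j ≤ 1 := by
  unfold bit; split_ifs
  · exact Bool.toNat_le _
  · omega

theorem bit_eq_zero_iff (t : SpinWord n) (i : Fin n) : bit t i = 0 ↔ t i = false := by
  rw [bit_coe]; cases t i <;> simp

theorem bit_eq_one_iff (t : SpinWord n) (i : Fin n) : bit t i = 1 ↔ t i = true := by
  rw [bit_coe]; cases t i <;> simp

theorem spinWord_ext {s t : SpinWord n} (h : ∀ i : Fin n, bit s i = bit t i) : s = t := by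
  funext i
  have := h i
  rw [bit_coe, bit_coe] at this
  revert this
  cases s i <;> cases t i <;> simp

theorem height_zero (t : SpinWord n) : height t 0 = bit t 0 := by simp [height]

theorem height_succ (t : SpinWord n) (j : ℕ) : height t (j + 1) = height t j + bit t (j + 1) :=
  Finset.sum_range_succ _ _

theorem height_le (t : SpinWord n) (j : ℕ) : height t j ≤ j + 1 := by
  induction j with
  | zero => rw [height_zero]; exact bit_le_one t 0
  | succ j ih => rw [height_succ]; have := bit_le_one t (j + 1); omega

theorem height_mono (t : SpinWord n) : Monotone (height t) :=
  monotone_nat_of_le_succ fun j => by rw [height_succ]; omega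

theorem height_injective {s t : SpinWord n} (h : ∀ i : Fin n, height s i = height t i) :
    s = t := by
  refine spinWord_ext fun i => ?_
  obtain ⟨i, hi⟩ := i
  cases i with
  | zero => simpa [height_zero] using h ⟨0, hi⟩
  | succ j =>
    have h1 := h ⟨j, by omega⟩
    have h2 := h ⟨j + 1, hi⟩
    simp only [height_succ] at h1 h2 ⊢
    omega

theorem toggle_toggle (i : Fin n) (t : SpinWord n) : toggle i (toggle i t) = t := by
  funext j; unfold toggle; split_ifs <;> simp

theorem toggle_comm (i j : Fin n) (t : SpinWord n) :
    toggle i (toggle j t) = toggle j (toggle i t) := by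
  funext k; unfold toggle; split_ifs <;> simp

theorem toggle_self (i : Fin n) (t : SpinWord n) : toggle i t i = !t i := by simp [toggle]

theorem toggle_next {i j : Fin n} (h : (j : ℕ) = i + 1) (t : SpinWord n) :
    toggle i t j = !t j := by simp [toggle, h]

theorem toggle_of_ne {i j : Fin n} (h : j ≠ i) (h' : (j : ℕ) ≠ i + 1) (t : SpinWord n) :
    toggle i t j = t j := by simp [toggle, h, h']

/-- Since bits lie in `{0, 1}`, the additive equation at `i` and at `i + 1` already forces the
source and target letters there. -/
theorem spinEdge_iff_bit (s t : SpinWord n) (i : Fin n) :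
    spinEdge s i t ↔ ∀ j : Fin n,
      (bit t j : ℤ) = bit s j + (if j = i then 1 else 0) - (if (j : ℕ) = i + 1 then 1 else 0) := by
  constructor
  · rintro ⟨h1, h2, rfl⟩ j
    simp only [bit_coe]
    by_cases hj : j = i
    · subst hj; simp [toggle_self, h1]
    · by_cases hj' : (j : ℕ) = i + 1
      · simp [toggle_next hj', h2 j hj', hj, hj']
      · simp [toggle_of_ne hj hj', hj, hj']
  · intro h
    have h1 : bit s i = 0 := by
      have := h i
      have := bit_le_one t i
      simp at *; omega
    have h2 : ∀ j : Fin n, (j : ℕ) = i + 1 → bit s j = 1 := by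
      intro j hj
      have := h j
      have := bit_le_one s j
      have hne : j ≠ i := fun e => by subst e; omega
      simp [hj, hne] at *; omega
    refine ⟨(bit_eq_zero_iff s i).1 h1, fun j hj => (bit_eq_one_iff s j).1 (h2 j hj), ?_⟩
    refine spinWord_ext fun j => ?_
    have h3 := h j
    by_cases hj : j = i
    · subst hj
      rw [bit_coe (toggle j s), toggle_self, (bit_eq_zero_iff s j).1 h1]
      simp at h3 ⊢; omega
    · by_cases hj' : (j : ℕ) = i + 1
      · have h4 := h2 j hj'
        rw [bit_coe (toggle i s), toggle_next hj', (bit_eq_one_iff s j).1 h4]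
        rw [h4] at h3
        simp [hj, hj'] at h3 ⊢; omega
      · rw [bit_coe (toggle i s), toggle_of_ne hj hj', ← bit_coe]
        simp [hj, hj'] at h3; omega

/-- Passing to partial sums telescopes `e_i - e_{i+1}` to a single unit at `i`. In these coordinates
the order on words is componentwise, and they are what matches the entries of `𝒵(n)`. -/
theorem spinEdge_iff_height (s t : SpinWord n) (i : Fin n) :
    spinEdge s i t ↔ ∀ j : Fin n, height t j = height s j + if j = i then 1 else 0 := by
  rw [spinEdge_iff_bit]
  constructor
  · intro h
    suffices H : ∀ j : ℕ, j < n → height t j = height s j + if j = (i : ℕ) then 1 else 0 by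
      intro j
      rw [H j j.2]
      simp [Fin.ext_iff]
    intro j
    induction j with
    | zero =>
      intro hj
      have := h ⟨0, hj⟩
      simp only [height_zero, Fin.ext_iff] at this ⊢
      split_ifs at this ⊢ <;> first | contradiction | omega
    | succ j ih =>
      intro hj
      have := h ⟨j + 1, hj⟩
      have ih := ih (by omega)
      simp only [height_succ, Fin.ext_iff] at this ih ⊢
      split_ifs at this ih ⊢ <;> omega
  · rintro h ⟨j, hj⟩
    cases j with
    | zero =>
      have := h ⟨0, hj⟩
      simp only [height_zero, Fin.ext_iff] at this ⊢
      split_ifs at this ⊢ <;> first | contradiction | omega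
    | succ j =>
      have h1 := h ⟨j, by omega⟩
      have h2 := h ⟨j + 1, hj⟩
      simp only [height_succ, Fin.ext_iff] at h1 h2 ⊢
      split_ifs at h1 h2 ⊢ <;> omega

theorem spinWt_eq_neg_one_iff (t : SpinWord n) (i : Fin n) :
    spinWt t i = -1 ↔ t i = false ∧ ∀ j : Fin n, (j : ℕ) = i + 1 → t j = true := by
  have h1 := bit_le_one t i
  have h2 := bit_le_one t (i + 1)
  rw [← bit_eq_zero_iff]
  unfold spinWt
  split_ifs with h
  · have : (∀ j : Fin n, (j : ℕ) = i + 1 → t j = true) ↔ bit t (i + 1) = 1 := by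
      constructor
      · intro H; exact (bit_eq_one_iff t ⟨i + 1, h⟩).2 (H _ rfl)
      · intro H j hj; rw [← bit_eq_one_iff, hj, H]
    rw [this]; omega
  · constructor
    · intro _; exact ⟨by omega, fun j hj => by omega⟩
    · intro H; omega

theorem spinWt_eq_one_iff (t : SpinWord n) (i : Fin n) :
    spinWt t i = 1 ↔ t i = true ∧ ∀ j : Fin n, (j : ℕ) = i + 1 → t j = false := by
  have h1 := bit_le_one t i
  have h2 := bit_le_one t (i + 1)
  rw [← bit_eq_one_iff]
  unfold spinWt
  split_ifs with h
  · have : (∀ j : Fin n, (j : ℕ) = i + 1 → t j = false) ↔ bit t (i + 1) = 0 := by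
      constructor
      · intro H; exact (bit_eq_zero_iff t ⟨i + 1, h⟩).2 (H _ rfl)
      · intro H j hj; rw [← bit_eq_zero_iff, hj, H]
    rw [this]; omega
  · constructor
    · intro _; exact ⟨by omega, fun j hj => by omega⟩
    · intro H; omega

theorem spinWt_trichotomy (t : SpinWord n) (i : Fin n) :
    spinWt t i = -1 ∨ spinWt t i = 0 ∨ spinWt t i = 1 := by
  have h1 := bit_le_one t i
  have h2 := bit_le_one t (i + 1)
  unfold spinWt
  split_ifs <;> omega

/-- With `spinEdge_iff_target` this shows that each color is a partial matching, and that the sign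
of the weight tells which end of an edge a word is. -/
theorem spinEdge_iff_source (s t : SpinWord n) (i : Fin n) :
    spinEdge s i t ↔ spinWt s i = -1 ∧ t = toggle i s := by
  rw [spinWt_eq_neg_one_iff, spinEdge, and_assoc]

theorem spinWt_toggle (t : SpinWord n) (i : Fin n) : spinWt (toggle i t) i = -spinWt t i := by
  have key : ∀ t : SpinWord n, spinWt t i = -1 → spinWt (toggle i t) i = 1 := by
    intro t h
    rw [spinWt_eq_neg_one_iff] at h
    rw [spinWt_eq_one_iff, toggle_self]
    exact ⟨by simp [h.1], fun j hj => by simp [toggle_next hj, h.2 j hj]⟩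
  have key' : ∀ t : SpinWord n, spinWt t i = 1 → spinWt (toggle i t) i = -1 := by
    intro t h
    rw [spinWt_eq_one_iff] at h
    rw [spinWt_eq_neg_one_iff, toggle_self]
    exact ⟨by simp [h.1], fun j hj => by simp [toggle_next hj, h.2 j hj]⟩
  rcases spinWt_trichotomy t i with h | h | h
  · rw [h, key t h]; rfl
  · rcases spinWt_trichotomy (toggle i t) i with h' | h' | h'
    · have := key _ h'; rw [toggle_toggle] at this; omega
    · rw [h, h']; rfl
    · have := key' _ h'; rw [toggle_toggle] at this; omega
  · rw [h, key' t h]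

theorem spinEdge_iff_target (s t : SpinWord n) (i : Fin n) :
    spinEdge s i t ↔ spinWt t i = 1 ∧ s = toggle i t := by
  rw [spinEdge_iff_source]
  constructor
  · rintro ⟨h, rfl⟩; rw [spinWt_toggle, h, toggle_toggle]; simp
  · rintro ⟨h, rfl⟩; rw [spinWt_toggle, h, toggle_toggle]; simp

theorem spinWt_add_simpleRoot {s t : SpinWord n} {i : Fin n} (h : spinEdge s i t) :
    spinWt s + simpleRoot (CartanMatrix.B n) i = spinWt t := by
  rw [spinEdge_iff_bit] at h
  funext ⟨j, hj⟩
  obtain ⟨i, hi⟩ := i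
  have h1 := h ⟨j, hj⟩
  simp only [Fin.ext_iff] at h1
  simp only [Pi.add_apply, simpleRoot, CartanMatrix.B, Matrix.of_apply, spinWt, Fin.ext_iff]
  by_cases hjn : j + 1 < n
  · have h2 := h ⟨j + 1, hjn⟩
    simp only [Fin.ext_iff] at h2
    rw [if_pos hjn, if_pos hjn]
    split_ifs at h1 h2 ⊢ <;> omega
  · rw [if_neg hjn, if_neg hjn]
    split_ifs at h1 ⊢ <;> omega

/-- Edges of two different colors commute: a valley can be completed to a diamond below if and
only if it can be completed above. -/
theorem spinEdge_diamond {i j : Fin n} (hij : i ≠ j) (u v : SpinWord n) :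
    (spinWt u i = 1 ∧ spinEdge (toggle i u) j v) ↔
      (spinWt u j = -1 ∧ spinEdge v i (toggle j u)) := by
  rw [spinEdge_iff_source, spinEdge_iff_target, toggle_comm j i, spinWt_eq_one_iff,
    spinWt_eq_neg_one_iff, spinWt_eq_one_iff, spinWt_eq_neg_one_iff]
  have hij' : (i : ℕ) ≠ j := fun e => hij (Fin.ext e)
  constructor
  · rintro ⟨⟨h1, h2⟩, ⟨h3, h4⟩, rfl⟩
    have n1 : (j : ℕ) ≠ i + 1 := by
      intro e; rw [toggle_next e, h2 j e] at h3; simp at h3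
    have n2 : (i : ℕ) ≠ j + 1 := by
      intro e; have := h4 i e; rw [toggle_self, h1] at this; simp at this
    rw [toggle_of_ne hij.symm n1] at h3
    refine ⟨⟨h3, fun k hk => ?_⟩, ⟨?_, fun k hk => ?_⟩, rfl⟩
    · have := h4 k hk
      rwa [toggle_of_ne (by rintro rfl; omega) (by omega)] at this
    · rwa [toggle_of_ne hij n2]
    · rw [toggle_of_ne (by rintro rfl; omega) (by omega)]; exact h2 k hk
  · rintro ⟨⟨h1, h2⟩, ⟨h3, h4⟩, rfl⟩
    have n2 : (i : ℕ) ≠ j + 1 := by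
      intro e; rw [toggle_next e, h2 i e] at h3; simp at h3
    have n1 : (j : ℕ) ≠ i + 1 := by
      intro e; have := h4 j e; rw [toggle_self, h1] at this; simp at this
    rw [toggle_of_ne hij n2] at h3
    refine ⟨⟨h3, fun k hk => ?_⟩, ⟨?_, fun k hk => ?_⟩, rfl⟩
    · have := h4 k hk
      rwa [toggle_of_ne (by rintro rfl; omega) (by omega)] at this
    · rwa [toggle_of_ne hij.symm n1]
    · rw [toggle_of_ne (by rintro rfl; omega) (by omega)]; exact h2 k hk

theorem isDiamondColored_spinEdge : IsDiamondColored (spinEdge (n := n)) := by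
  intro v s t u i j k l hst h1 h2 h3 h4
  -- The target of an edge is determined by its source and color, so distinct targets need distinct
  -- colors. The colors of the two upper edges are then read off from the partial sum that each path
  -- still has to raise.
  have hkl : k ≠ l := by
    rintro rfl
    exact hst (((spinEdge_iff_source _ _ _).1 h1).2.trans ((spinEdge_iff_source _ _ _).1 h2).2.symm)
  rw [spinEdge_iff_height] at h1 h2 h3 h4
  constructor
  · have a1 := h1 l; have a2 := h2 l; have a3 := h3 l; have a4 := h4 l
    rw [if_neg hkl.symm] at a1
    by_contra hne
    rw [if_neg (Ne.symm hne)] at a3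
    rw [if_pos rfl] at a2
    omega
  · have a1 := h1 k; have a2 := h2 k; have a3 := h3 k; have a4 := h4 k
    rw [if_neg hkl] at a2
    by_contra hne
    rw [if_neg (Ne.symm hne)] at a4
    rw [if_pos rfl] at a1
    omega

end SpinWords

/-! ### Weights in components with one or two vertices -/

section ComponentsOfSizeTwo

variable {V I : Type*}

theorem component_subset_of_closed {E : V → I → V → Prop} {i : I} {x : V} {S : Set V} (hx : x ∈ S)
    (h : ∀ s t, E s i t → (s ∈ S ↔ t ∈ S)) : component E i x ⊆ S := by
  intro y hy
  have : ∀ a b, Relation.EqvGen (fun s t => E s i t) a b → (a ∈ S ↔ b ∈ S) := by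
    intro a b hab
    induction hab with
    | rel a b h' => exact h a b h'
    | refl => rfl
    | symm _ _ _ ih => exact ih.symm
    | trans _ _ _ _ _ ih1 ih2 => exact ih1.trans ih2
  exact (this x y hy).1 hx

theorem componentRank_spec {E : V → I → V → Prop} {i : I} {x : V} {ρ : V → ℕ} {l : ℕ}
    (h : IsRankFunctionOn (fun s t => E s i t) (component E i x) ρ l) :
    IsRankFunctionOn (fun s t => E s i t) (component E i x)
      (componentRank E i x).1 (componentRank E i x).2 :=
  Classical.epsilon_spec (p := fun p : (V → ℕ) × ℕ =>
    IsRankFunctionOn (fun s t => E s i t) (component E i x) p.1 p.2) ⟨(ρ, l), h⟩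

theorem posetWt_eq_zero {E : V → I → V → Prop} {i : I} {x : V}
    (h1 : ∀ y, ¬ E x i y) (h2 : ∀ y, ¬ E y i x) : posetWt E x i = 0 := by
  have hC : component E i x = {x} := by
    refine Set.Subset.antisymm (component_subset_of_closed rfl fun s t h => ?_)
      (Set.singleton_subset_iff.2 (Relation.EqvGen.refl x))
    constructor
    · rintro rfl; exact absurd h (h1 t)
    · rintro rfl; exact absurd h (h2 s)
  have hR : IsRankFunctionOn (fun s t => E s i t) (component E i x) (fun _ => 0) 0 := by
    rw [hC]
    refine ⟨by ext; simp, ?_⟩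
    rintro s rfl t rfl h
    exact absurd h (h1 _)
  obtain ⟨h3, -⟩ := componentRank_spec hR
  rw [hC, Set.image_singleton] at h3
  have h4 : (componentRank E i x).2 ∈ ({(componentRank E i x).1 x} : Set ℕ) := by
    rw [h3]; exact Set.self_mem_Iic
  have h5 : 0 ∈ ({(componentRank E i x).1 x} : Set ℕ) := by
    rw [h3]; simp
  simp only [Set.mem_singleton_iff] at h4 h5
  simp only [posetWt, colorDepth, colorRank]
  omega

/-- The hypothesis `h` says that no other edge of color `i` meets `x` or `y`, so `{x, y}` is a whole
component. -/
theorem posetWt_of_edge {E : V → I → V → Prop} {i : I} {x y : V} (hxy : E x i y) (hne : x ≠ y)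
    (h : ∀ s t, E s i t → (s = x ↔ t = y) ∧ s ≠ y ∧ t ≠ x) :
    posetWt E x i = -1 ∧ posetWt E y i = 1 := by
  have hS : ∀ s t, E s i t → (s ∈ ({x, y} : Set V) ↔ t ∈ ({x, y} : Set V)) := by
    intro s t hst
    obtain ⟨h1, h2, h3⟩ := h s t hst
    simp [h2, h3, h1]
  have hrel : Relation.EqvGen (fun s t => E s i t) x y := .rel _ _ hxy
  have hCx : component E i x = {x, y} := by
    refine Set.Subset.antisymm (component_subset_of_closed (by simp) hS) ?_
    rintro z (rfl | rfl)
    exacts [.refl _, hrel]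
  have hCy : component E i y = {x, y} := by
    refine Set.Subset.antisymm (component_subset_of_closed (by simp) hS) ?_
    rintro z (rfl | rfl)
    exacts [hrel.symm, .refl _]
  classical
  have hR : IsRankFunctionOn (fun s t => E s i t) {x, y} (fun z => if z = y then 1 else 0) 1 := by
    refine ⟨?_, ?_⟩
    · rw [Set.image_pair, if_neg hne, if_pos rfl]
      ext k
      simp only [Set.mem_insert_iff, Set.mem_singleton_iff, Set.mem_Iic]
      omega
    · intro s _ t ht hst
      obtain ⟨h1, h2, h3⟩ := h s t hst
      have : t = y := by simpa [h3] using ht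
      simp [h2, this]
  -- `componentRank` is an arbitrary choice among rank functions, so its values must be forced.
  have key : ∀ (ρ : V → ℕ) (l : ℕ), IsRankFunctionOn (fun s t => E s i t) {x, y} ρ l →
      ρ x = 0 ∧ ρ y = 1 ∧ l = 1 := by
    rintro ρ l ⟨h1, h2⟩
    have h3 := h2 x (by simp) y (by simp) hxy
    rw [Set.image_pair] at h1
    have h4 : (0 : ℕ) ∈ ({ρ x, ρ y} : Set ℕ) := by rw [h1]; simp
    have h5 : l ∈ ({ρ x, ρ y} : Set ℕ) := by rw [h1]; simp
    have h6 : ρ y ∈ Set.Iic l := by rw [← h1]; simp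
    simp only [Set.mem_insert_iff, Set.mem_singleton_iff, Set.mem_Iic] at h4 h5 h6
    omega
  constructor
  · obtain ⟨h1, h2, h3⟩ := key _ _ (hCx ▸ componentRank_spec (hCx.symm ▸ hR))
    simp only [posetWt, colorDepth, colorRank, h1, h3]
    rfl
  · obtain ⟨h1, h2, h3⟩ := key _ _ (hCy ▸ componentRank_spec (hCy.symm ▸ hR))
    simp only [posetWt, colorDepth, colorRank, h2, h3]
    rfl

end ComponentsOfSizeTwo

/-! ### Digraphs isomorphic to the spin digraph -/

section SpinDigraphs

variable {V : Type*} {n : ℕ}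

/-- An isomorphism of edge-colored digraphs onto the spin digraph. -/
def IsSpinIso (E : V → Fin n → V → Prop) (e : V ≃ SpinWord n) : Prop :=
  ∀ s i t, E s i t ↔ spinEdge (e s) i (e t)

/-- The character of the spin representation. -/
noncomputable def spinCharacter (n : ℕ) : AddMonoidAlgebra ℤ (Fin n → ℤ) :=
  ∑ t : SpinWord n, AddMonoidAlgebra.single (spinWt t) 1

variable {E : V → Fin n → V → Prop} {e : V ≃ SpinWord n}

theorem IsSpinIso.posetWt_eq (h : IsSpinIso E e) (x : V) : posetWt E x = spinWt (e x) := by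
  funext i
  have key : ∀ x, spinWt (e x) i = -1 →
      posetWt E x i = -1 ∧ posetWt E (e.symm (toggle i (e x))) i = 1 := by
    intro x hx
    apply posetWt_of_edge
    · rw [h, spinEdge_iff_source]; simp [hx]
    · intro hxx
      have := congrArg (fun z => spinWt (e z) i) hxx
      simp [spinWt_toggle, hx] at this
    · intro s t hst
      rw [h] at hst
      have hs := hst
      rw [spinEdge_iff_source] at hs
      rw [spinEdge_iff_target] at hst
      refine ⟨⟨?_, ?_⟩, ?_, ?_⟩
      · rintro rfl; rw [← hs.2]; simp
      · rintro rfl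
        apply e.injective
        rw [hst.2, e.apply_symm_apply, toggle_toggle]
      · rintro rfl
        have := hs.1
        simp [spinWt_toggle, hx] at this
      · rintro rfl
        have := hst.1
        omega
  rcases spinWt_trichotomy (e x) i with hx | hx | hx
  · rw [hx]; exact (key x hx).1
  · rw [hx]
    apply posetWt_eq_zero
    · intro y hy; rw [h, spinEdge_iff_source] at hy; omega
    · intro y hy; rw [h, spinEdge_iff_target] at hy; omega
  · rw [hx]
    have := (key (e.symm (toggle i (e x))) (by simp [spinWt_toggle, hx])).2
    simpa [toggle_toggle] using this

theorem IsSpinIso.isStructured (h : IsSpinIso E e) : IsStructured (CartanMatrix.B n) E := by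
  intro s i t hst
  rw [h.posetWt_eq, h.posetWt_eq]
  exact spinWt_add_simpleRoot ((h s i t).1 hst)

theorem IsSpinIso.isDiamondColored (h : IsSpinIso E e) : IsDiamondColored E := by
  intro v s t u i j k l hst h1 h2 h3 h4
  rw [h] at h1 h2 h3 h4
  exact isDiamondColored_spinEdge _ _ _ _ i j k l (e.injective.ne hst) h1 h2 h3 h4

theorem IsSpinIso.weightGenFun_eq [Fintype V] (h : IsSpinIso E e) :
    weightGenFun E = spinCharacter n := by
  unfold weightGenFun spinCharacter
  simp_rw [h.posetWt_eq]
  exact e.sum_comp fun t => AddMonoidAlgebra.single (spinWt t) (1 : ℤ)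

end SpinDigraphs

/-! ### Orthogonal coordinates on the weight lattice -/

section SignCoordinates

variable {n : ℕ}

/-- Twice the coordinates of a weight with respect to an orthonormal basis in which the Weyl group
of type `B` acts by signed permutations. -/
def signCoord (n : ℕ) : (Fin n → ℤ) →ₗ[ℤ] (Fin n → ℤ) :=
  Matrix.mulVecLin (Matrix.of fun i j : Fin n =>
    if i ≤ j then (if (j : ℕ) + 1 < n then (2 : ℤ) else 1) else 0)

theorem signCoord_apply (m : Fin n → ℤ) (i : Fin n) :
    signCoord n m i =
      ∑ j : Fin n, (if i ≤ j then (if (j : ℕ) + 1 < n then (2 : ℤ) else 1) else 0) * m j := rfl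

theorem signCoord_last (m : Fin n → ℤ) {i : Fin n} (h : (i : ℕ) + 1 = n) :
    signCoord n m i = m i := by
  rw [signCoord_apply, Finset.sum_eq_single i]
  · simp [h]
  · intro j _ hj
    rw [if_neg, zero_mul]
    intro hij
    exact hj (Fin.ext (by have := Fin.le_def.1 hij; omega))
  · simp

/-- With `signCoord_last` this recursion determines the coordinates from the last one backwards, so
later computations never touch the matrix. -/
theorem signCoord_next (m : Fin n → ℤ) {i j : Fin n} (h : (j : ℕ) = i + 1) :
    signCoord n m i = signCoord n m j + 2 * m i := by
  rw [← sub_eq_iff_eq_add', signCoord_apply, signCoord_apply, ← Finset.sum_sub_distrib,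
    Finset.sum_eq_single i]
  · have h1 : ¬ j ≤ i := by rw [Fin.le_def]; omega
    have h2 : (i : ℕ) + 1 < n := by omega
    simp [h1, h2]
  · intro k _ hk
    have : i ≤ k ↔ j ≤ k := by
      rw [Fin.le_def, Fin.le_def]
      have : (k : ℕ) ≠ i := fun e => hk (Fin.ext e)
      omega
    simp [this]
  · simp

theorem eq_of_next_of_last {P : Fin n → Prop} (h1 : ∀ i j : Fin n, (j : ℕ) = i + 1 → P j → P i)
    (h2 : ∀ i : Fin n, (i : ℕ) + 1 = n → P i) (i : Fin n) : P i := by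
  suffices H : ∀ (k : ℕ) (i : Fin n), (i : ℕ) + 1 + k = n → P i from H (n - i - 1) i (by omega)
  intro k
  induction k with
  | zero => exact fun i hi => h2 i hi
  | succ k ih => exact fun i hi => h1 i ⟨i + 1, by omega⟩ rfl (ih _ (by simp; omega))

theorem signCoord_eq {m y : Fin n → ℤ} (h1 : ∀ i j : Fin n, (j : ℕ) = i + 1 → y i = y j + 2 * m i)
    (h2 : ∀ i : Fin n, (i : ℕ) + 1 = n → y i = m i) : signCoord n m = y := by
  funext i
  refine eq_of_next_of_last (P := fun i => signCoord n m i = y i) ?_ ?_ i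
  · intro i j hij h
    rw [signCoord_next m hij, h1 i j hij, h]
  · intro i hi
    rw [signCoord_last m hi, h2 i hi]

theorem signCoord_injective : Function.Injective (signCoord n) := by
  intro m m' h
  funext i
  have hi := congrFun h i
  by_cases hn : (i : ℕ) + 1 < n
  · have hj := congrFun h ⟨i + 1, hn⟩
    rw [signCoord_next m (j := ⟨i + 1, hn⟩) rfl, signCoord_next m' (j := ⟨i + 1, hn⟩) rfl] at hi
    omega
  · rwa [signCoord_last m (by omega), signCoord_last m' (by omega)] at hi

theorem signCoord_simpleRoot (i : Fin n) :
    signCoord n (simpleRoot (CartanMatrix.B n) i) =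
      fun j => (if j = i then 2 else 0) - (if (j : ℕ) = i + 1 then 2 else 0) := by
  apply signCoord_eq
  · intro j k hjk
    simp only [simpleRoot, CartanMatrix.B, Matrix.of_apply, Fin.ext_iff]
    split_ifs <;> first | contradiction | omega
  · intro j hj
    simp only [simpleRoot, CartanMatrix.B, Matrix.of_apply, Fin.ext_iff]
    split_ifs <;> first | contradiction | omega

theorem signCoord_spinWt (t : SpinWord n) :
    signCoord n (spinWt t) = fun j : Fin n => 2 * (bit t j : ℤ) - 1 := by
  apply signCoord_eq
  · intro i j hij
    have : (i : ℕ) + 1 < n := by omega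
    simp only [spinWt, if_pos this, hij]
    ring
  · intro i hi
    have : ¬ (i : ℕ) + 1 < n := by omega
    simp only [spinWt, if_neg this]

theorem signCoord_weylVector :
    signCoord n (weylVector (Fin n)) = fun j : Fin n => 2 * ((n : ℤ) - j) - 1 := by
  apply signCoord_eq
  · intro i j hij
    simp only [weylVector, hij]; push_cast; ring
  · intro i hi
    simp only [weylVector]; omega

theorem spinWt_injective : Function.Injective (spinWt (n := n)) := by
  intro s t h
  refine spinWord_ext fun i => ?_
  have := congrFun (congrArg (signCoord n) h) i
  simp only [signCoord_spinWt] at this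
  omega

end SignCoordinates

/-! ### The Weyl group as signed permutations, and the bialternant -/

section WeylGroupOfTypeB

variable {n : ℕ}

/-- The linear automorphism acts by a signed permutation of the sign coordinates. -/
def IsSignedPerm (w : (Fin n → ℤ) ≃ₗ[ℤ] (Fin n → ℤ)) (σ : Equiv.Perm (Fin n)) (ε : Fin n → ℤˣ) :
    Prop :=
  ∀ m j, signCoord n (w m) j = ε j * signCoord n m (σ j)

/-- The reflection in a long simple root swaps two adjacent coordinates, the one in the short simple
root negates the last, and signed permutations are closed under products and inverses. -/
theorem exists_isSignedPerm {w : (Fin n → ℤ) ≃ₗ[ℤ] (Fin n → ℤ)}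
    (hw : w ∈ weylGroup (CartanMatrix.B n)) : ∃ σ ε, IsSignedPerm w σ ε := by
  induction hw using Subgroup.closure_induction with
  | mem w hw =>
    obtain ⟨i, hi⟩ := hw
    have key : ∀ m j, signCoord n (w m) j = signCoord n m j -
        m i * ((if j = i then 2 else 0) - (if (j : ℕ) = i + 1 then 2 else 0)) := by
      intro m j
      rw [hi, map_sub, map_smul, signCoord_simpleRoot]
      rfl
    by_cases hn : (i : ℕ) + 1 < n
    · refine ⟨Equiv.swap i ⟨i + 1, hn⟩, 1, fun m j => ?_⟩
      have hnext := signCoord_next m (i := i) (j := ⟨i + 1, hn⟩) rfl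
      rw [key]
      simp only [Pi.one_apply, Units.val_one, one_mul]
      by_cases h1 : j = i
      · subst h1
        rw [Equiv.swap_apply_left, hnext]
        simp; ring
      · by_cases h2 : (j : ℕ) = i + 1
        · obtain rfl : j = ⟨i + 1, hn⟩ := Fin.ext h2
          rw [Equiv.swap_apply_right, hnext]
          simp [Fin.ext_iff]; ring
        · rw [Equiv.swap_apply_of_ne_of_ne h1 (fun e => h2 (by rw [e]))]
          simp [h1, h2]
    · refine ⟨1, fun j => if j = i then -1 else 1, fun m j => ?_⟩
      rw [key]
      have h2 : (j : ℕ) ≠ i + 1 := by omega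
      by_cases h1 : j = i
      · subst h1
        rw [Equiv.Perm.one_apply, signCoord_last m (by omega)]
        simp; ring
      · simp [h1, h2]
  | one => exact ⟨1, 1, fun m j => by simp⟩
  | mul w w' _ _ h h' =>
    obtain ⟨σ, ε, h⟩ := h
    obtain ⟨σ', ε', h'⟩ := h'
    refine ⟨σ' * σ, fun j => ε j * ε' (σ j), fun m j => ?_⟩
    rw [LinearEquiv.mul_apply, h, h']
    simp [mul_assoc]
  | inv w _ h =>
    obtain ⟨σ, ε, h⟩ := h
    refine ⟨σ.symm, fun j => ε (σ.symm j), fun m j => ?_⟩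
    have := h (w⁻¹ m) (σ.symm j)
    rw [← LinearEquiv.mul_apply, mul_inv_cancel, Equiv.apply_symm_apply] at this
    rw [LinearEquiv.coe_one, id] at this
    rw [this, ← mul_assoc, ← Units.val_mul, Int.units_mul_self, Units.val_one, one_mul]

theorem eq_of_isSignedPerm {w w' : (Fin n → ℤ) ≃ₗ[ℤ] (Fin n → ℤ)} {σ : Equiv.Perm (Fin n)}
    {ε : Fin n → ℤˣ} (h : IsSignedPerm w σ ε) (h' : IsSignedPerm w' σ ε) : w = w' :=
  LinearEquiv.ext fun m => signCoord_injective (funext fun j => by rw [h, h'])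

instance finite_weylGroup_B : Finite (weylGroup (CartanMatrix.B n)) := by
  choose σ ε h using fun w : weylGroup (CartanMatrix.B n) => exists_isSignedPerm w.2
  refine Finite.of_injective (fun w => (σ w, ε w)) fun w w' hww => ?_
  obtain ⟨h1, h2⟩ := Prod.ext_iff.1 hww
  have hw' := h w'
  dsimp only at h1 h2
  rw [← h1, ← h2] at hw'
  exact Subtype.ext (eq_of_isSignedPerm (h w) hw')

noncomputable instance fintype_weylGroup_B : Fintype (weylGroup (CartanMatrix.B n)) :=
  Fintype.ofFinite _

/-- The doubled coordinates of `ϱ` are `2n - 1, …, 3, 1`. They are positive, so no sign can change,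
and distinct, so no position can move. -/
theorem eq_one_of_apply_weylVector {w : (Fin n → ℤ) ≃ₗ[ℤ] (Fin n → ℤ)}
    (hw : w ∈ weylGroup (CartanMatrix.B n)) (h : w (weylVector (Fin n)) = weylVector (Fin n)) :
    w = 1 := by
  obtain ⟨σ, ε, hσ⟩ := exists_isSignedPerm hw
  have key : ∀ j, σ j = j ∧ ε j = 1 := by
    intro j
    have := hσ (weylVector (Fin n)) j
    rw [h, signCoord_weylVector] at this
    have h1 := j.2
    have h2 := (σ j).2
    rcases Int.units_eq_one_or (ε j) with e | e
    · rw [e] at this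
      refine ⟨Fin.ext ?_, e⟩
      simp at this
      omega
    · rw [e] at this
      simp at this
      omega
  refine eq_of_isSignedPerm (σ := σ) (ε := ε) hσ fun m j => ?_
  rw [(key j).1, (key j).2]
  simp

/-- The reflection in a simple root. -/
def simpleReflection (i : Fin n) : (Fin n → ℤ) ≃ₗ[ℤ] (Fin n → ℤ) :=
  Module.reflection (x := simpleRoot (CartanMatrix.B n) i) (f := LinearMap.proj i)
    (by simp [simpleRoot, CartanMatrix.B])

theorem simpleReflection_apply (i : Fin n) (m : Fin n → ℤ) :
    simpleReflection i m = m - m i • simpleRoot (CartanMatrix.B n) i :=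
  Module.reflection_apply _ _

theorem simpleReflection_mem (i : Fin n) : simpleReflection i ∈ weylGroup (CartanMatrix.B n) :=
  Subgroup.subset_closure ⟨i, simpleReflection_apply i⟩

theorem simpleReflection_mul_self (i : Fin n) : simpleReflection i * simpleReflection i = 1 :=
  LinearEquiv.ext fun m => Module.involutive_reflection _ m

theorem det_simpleReflection (i : Fin n) :
    LinearMap.det (simpleReflection i : (Fin n → ℤ) →ₗ[ℤ] (Fin n → ℤ)) = -1 := by
  have : (simpleReflection i : (Fin n → ℤ) →ₗ[ℤ] (Fin n → ℤ)) =
      LinearMap.transvection (LinearMap.proj i) (-simpleRoot (CartanMatrix.B n) i) := by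
    refine LinearMap.ext fun m => ?_
    rw [LinearEquiv.coe_coe, simpleReflection_apply, LinearMap.transvection.apply]
    simp [sub_eq_add_neg]
  rw [this, LinearMap.transvection.det]
  simp [simpleRoot, CartanMatrix.B]

/-- The determinant of an element of the Weyl group. -/
noncomputable def weylDet (w : weylGroup (CartanMatrix.B n)) : ℤ :=
  LinearMap.det ((w : (Fin n → ℤ) ≃ₗ[ℤ] (Fin n → ℤ)) : (Fin n → ℤ) →ₗ[ℤ] (Fin n → ℤ))

theorem alternant_single (m : Fin n → ℤ) :
    alternant (CartanMatrix.B n) (AddMonoidAlgebra.single m 1) =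
      ∑ w : weylGroup (CartanMatrix.B n), weylDet w •
        AddMonoidAlgebra.single ((w : (Fin n → ℤ) ≃ₗ[ℤ] (Fin n → ℤ)) m) (1 : ℤ) := by
  unfold alternant
  rw [finsum_eq_sum_of_fintype]
  simp_rw [AddMonoidAlgebra.mapDomain_single]
  rfl

theorem weylDet_mul_simpleReflection (w : weylGroup (CartanMatrix.B n)) (i : Fin n) :
    weylDet (w * ⟨simpleReflection i, simpleReflection_mem i⟩) = -weylDet w := by
  have : weylDet (w * ⟨simpleReflection i, simpleReflection_mem i⟩) =
      LinearMap.det (((w : (Fin n → ℤ) ≃ₗ[ℤ] (Fin n → ℤ)) : (Fin n → ℤ) →ₗ[ℤ] (Fin n → ℤ)) *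
        (simpleReflection i : (Fin n → ℤ) →ₗ[ℤ] (Fin n → ℤ))) := rfl
  rw [this, map_mul, det_simpleReflection, mul_neg_one]
  rfl

theorem weylDet_ne_zero (w : weylGroup (CartanMatrix.B n)) : weylDet w ≠ 0 :=
  (LinearEquiv.isUnit_det' _).ne_zero

/-- The reflection `s_i` fixes `m`, so the terms of `w` and `w * s_i` cancel. -/
theorem alternant_single_eq_zero {m : Fin n → ℤ} {i : Fin n} (h : m i = 0) :
    alternant (CartanMatrix.B n) (AddMonoidAlgebra.single m 1) = 0 := by
  have hfix : simpleReflection i m = m := by rw [simpleReflection_apply, h]; simp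
  rw [alternant_single]
  refine Finset.sum_involution
    (fun w _ => w * ⟨simpleReflection i, simpleReflection_mem i⟩) ?_ ?_ ?_ ?_
  · intro w _
    rw [weylDet_mul_simpleReflection, Subgroup.coe_mul, LinearEquiv.mul_apply, hfix, neg_smul,
      add_neg_cancel]
  · intro w _ _ e
    have := congrArg weylDet e
    rw [weylDet_mul_simpleReflection] at this
    have := weylDet_ne_zero w
    omega
  · intro w _; exact Finset.mem_univ _
  · intro w _
    refine Subtype.ext ?_
    simp [mul_assoc, simpleReflection_mul_self]

/-- Since `ϱ` has trivial stabilizer, only the identity contributes to the coefficient at `ϱ`, which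
is therefore `1`. -/
theorem alternant_weylVector_ne_zero :
    alternant (CartanMatrix.B n) (AddMonoidAlgebra.single (weylVector (Fin n)) 1) ≠ 0 := by
  intro h
  have := congrArg (fun f => f.coeff (weylVector (Fin n))) h
  simp only [alternant_single, AddMonoidAlgebra.coeff_sum, AddMonoidAlgebra.coeff_smul,
    AddMonoidAlgebra.coeff_single, AddMonoidAlgebra.coeff_zero, Finsupp.finsetSum_apply,
    Finsupp.smul_apply, Finsupp.coe_zero, Pi.zero_apply] at this
  rw [Finset.sum_eq_single 1] at this
  · simp [weylDet] at this
  · intro w _ hw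
    rw [Finsupp.single_eq_of_ne, smul_zero]
    intro e
    exact hw (Subtype.ext (eq_one_of_apply_weylVector w.2 e.symm))
  · simp

theorem exists_spinWt_eq {w : (Fin n → ℤ) ≃ₗ[ℤ] (Fin n → ℤ)}
    (hw : w ∈ weylGroup (CartanMatrix.B n)) (t : SpinWord n) : ∃ t', spinWt t' = w (spinWt t) := by
  obtain ⟨σ, ε, h⟩ := exists_isSignedPerm hw
  refine ⟨fun j => decide (signCoord n (w (spinWt t)) j = 1), signCoord_injective ?_⟩
  rw [signCoord_spinWt]
  funext j
  rw [bit_coe, h, signCoord_spinWt]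
  have := bit_le_one t (σ j)
  rcases Int.units_eq_one_or (ε j) with e | e <;>
    obtain hb | hb : bit t (σ j) = 0 ∨ bit t (σ j) = 1 := by omega
  all_goals simp [e, hb]

/-- Signed permutations preserve the set of vectors with all doubled coordinates `±1`, so `w` merely
permutes the spin weights. -/
theorem sum_single_apply_spinWt (w : weylGroup (CartanMatrix.B n)) :
    ∑ t : SpinWord n,
      AddMonoidAlgebra.single ((w : (Fin n → ℤ) ≃ₗ[ℤ] (Fin n → ℤ)) (spinWt t)) (1 : ℤ) =
      spinCharacter n := by
  choose f hf using exists_spinWt_eq w.2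
  have hinj : Function.Injective f := by
    intro s t hst
    have := congrArg spinWt hst
    rw [hf, hf] at this
    exact spinWt_injective ((w : (Fin n → ℤ) ≃ₗ[ℤ] (Fin n → ℤ)).injective this)
  simp_rw [← hf]
  exact (Finite.injective_iff_bijective.1 hinj).sum_comp
    fun t => AddMonoidAlgebra.single (spinWt t) (1 : ℤ)

theorem alternant_mul_spinCharacter (m : Fin n → ℤ) :
    alternant (CartanMatrix.B n) (AddMonoidAlgebra.single m 1) * spinCharacter n =
      ∑ t : SpinWord n,
        alternant (CartanMatrix.B n) (AddMonoidAlgebra.single (spinWt t + m) 1) := by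
  simp_rw [alternant_single]
  rw [Finset.sum_mul, Finset.sum_comm]
  refine Finset.sum_congr rfl fun w _ => ?_
  -- The character is replaced by its `w`-translate separately in each term, so that `w` acts on the
  -- whole sum of exponents.
  rw [← sum_single_apply_spinWt w, Finset.mul_sum]
  refine Finset.sum_congr rfl fun t _ => ?_
  rw [smul_mul_assoc, AddMonoidAlgebra.single_mul_single, mul_one, map_add, add_comm]

/-- The last zero of the word is followed by a one or by the end, and its position works. -/
theorem exists_spinWt_eq_neg_one {t : SpinWord n} (h : ∃ i, t i = false) :
    ∃ i, spinWt t i = -1 := by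
  by_contra! hne
  obtain ⟨i, hi⟩ := h
  have : ∀ i, t i = true := by
    refine eq_of_next_of_last ?_ ?_
    · intro i j hij hj
      by_contra hi
      refine hne i ((spinWt_eq_neg_one_iff t i).2 ⟨by simpa using hi, fun k hk => ?_⟩)
      rwa [show k = j from Fin.ext (by omega)]
    · intro j hj
      by_contra hi
      exact hne j ((spinWt_eq_neg_one_iff t j).2 ⟨by simpa using hi, fun k hk => by omega⟩)
  simp [this] at hi

/-- The spin representation is minuscule: its character is the Weyl bialternant of its highest
weight. -/
theorem isWeylBialternant_spinCharacter (last : Fin n) (hlast : (last : ℕ) + 1 = n) :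
    IsWeylBialternant (CartanMatrix.B n) (fundamentalWeight last) (spinCharacter n) := by
  have key : alternant (CartanMatrix.B n) (AddMonoidAlgebra.single (weylVector (Fin n)) 1) *
      spinCharacter n = alternant (CartanMatrix.B n)
        (AddMonoidAlgebra.single (fundamentalWeight last + weylVector (Fin n)) 1) := by
    rw [alternant_mul_spinCharacter, Finset.sum_eq_single (fun _ => true)]
    · congr 3
      funext i
      have hb : ∀ j < n, bit (n := n) (fun _ => true) j = 1 := fun j hj => by simp [bit, hj]
      simp only [spinWt, fundamentalWeight, Pi.single_apply, Fin.ext_iff, hb i i.2]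
      by_cases hi : (i : ℕ) + 1 < n
      · rw [if_pos hi, hb _ hi, if_neg (by omega)]; rfl
      · rw [if_neg hi, if_pos (by omega)]; rfl
    · intro t _ ht
      -- All coordinates of `ϱ` are `1`, so here coordinate `i` of the shifted weight vanishes.
      obtain ⟨i, hi⟩ : ∃ i, spinWt t i = -1 := by
        apply exists_spinWt_eq_neg_one
        by_contra! h
        exact ht (funext fun i => by simpa using h i)
      exact alternant_single_eq_zero (i := i) (by simp [hi, weylVector])
    · simp
  refine ⟨key, fun χ' h' => ?_⟩
  exact mul_left_cancel₀ alternant_weylVector_ne_zero (h'.trans key.symm)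

end WeylGroupOfTypeB

/-! ### The rank of a word -/

section SpinRank

variable {n : ℕ}

/-- The rank of a word in the spin lattice. -/
def spinRank (t : SpinWord n) : ℕ := ∑ i : Fin n, height t i

theorem height_eq_sum (t : SpinWord n) (i : Fin n) :
    height t i = ∑ j : Fin n, if j ≤ i then bit t j else 0 := by
  have h1 : ∑ j : Fin n, (if j ≤ i then bit t j else 0) =
      ∑ j ∈ Finset.range n, if j ≤ (i : ℕ) then bit t j else 0 :=
    Fin.sum_univ_eq_sum_range (fun j => if j ≤ (i : ℕ) then bit t j else 0) n
  rw [h1, ← Finset.sum_filter, height]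
  refine Finset.sum_congr ?_ fun _ _ => rfl
  ext j
  simp only [Finset.mem_range, Finset.mem_filter]
  omega

/-- Double counting: the bit at `j` enters the partial sums at `j, …, n - 1`. -/
theorem spinRank_eq_sum (t : SpinWord n) : spinRank t = ∑ j : Fin n, (n - j) * bit t j := by
  unfold spinRank
  simp_rw [height_eq_sum]
  rw [Finset.sum_comm]
  refine Finset.sum_congr rfl fun j _ => ?_
  rw [← Finset.sum_filter, Finset.sum_const, smul_eq_mul]
  congr 1
  rw [show (Finset.univ.filter fun i => j ≤ i) = Finset.Ici j by ext; simp, Fin.card_Ici]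

theorem spinRank_of_spinEdge {s t : SpinWord n} {i : Fin n} (h : spinEdge s i t) :
    spinRank t = spinRank s + 1 := by
  rw [spinEdge_iff_height] at h
  unfold spinRank
  simp_rw [h]
  rw [Finset.sum_add_distrib]
  simp

/-- The length of the spin lattice. -/
def spinLength (n : ℕ) : ℕ := ∑ j : Fin n, (n - j)

theorem spinRank_le (t : SpinWord n) : spinRank t ≤ spinLength n := by
  rw [spinRank_eq_sum]
  refine Finset.sum_le_sum fun j _ => ?_
  exact (Nat.mul_le_mul_left _ (bit_le_one t j)).trans_eq (mul_one _)

theorem spinRank_top : spinRank (fun _ : Fin n => true) = spinLength n := by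
  rw [spinRank_eq_sum]
  refine Finset.sum_congr rfl fun j _ => ?_
  simp [bit_coe]

theorem spinRank_compl (t : SpinWord n) : spinRank (fun j => !t j) + spinRank t = spinLength n := by
  rw [spinRank_eq_sum, spinRank_eq_sum, ← Finset.sum_add_distrib]
  refine Finset.sum_congr rfl fun j _ => ?_
  simp only [bit_coe]
  cases t j <;> simp

/-- The coefficients of the grading element of the principal `𝔰𝔩₂` in terms of the simple
coroots. -/
def principalCoeff (i : Fin n) : ℕ :=
  ∑ j : Fin n, (n - j) * (if j ≤ i then (if (i : ℕ) + 1 < n then 2 else 1) else 0)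

/-- Pairing the doubled coordinates `2b_j - 1` with `n - j` gives the right side; expanding them in
the fundamental weights gives the coefficients on the left. -/
theorem sum_principalCoeff_mul_spinWt (t : SpinWord n) :
    ∑ i : Fin n, (principalCoeff i : ℤ) * spinWt t i = 2 * spinRank t - spinLength n := by
  have h : ∑ j : Fin n, ((n - j : ℕ) : ℤ) * signCoord n (spinWt t) j =
      2 * spinRank t - spinLength n := by
    rw [signCoord_spinWt, spinRank_eq_sum, spinLength]
    push_cast
    rw [Finset.mul_sum, ← Finset.sum_sub_distrib]
    exact Finset.sum_congr rfl fun j _ => by ring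
  rw [← h]
  simp_rw [signCoord_apply, Finset.mul_sum]
  rw [Finset.sum_comm]
  refine Finset.sum_congr rfl fun i _ => ?_
  rw [principalCoeff, Nat.cast_sum, Finset.sum_mul]
  refine Finset.sum_congr rfl fun j _ => ?_
  push_cast
  ring

end SpinRank

/-! ### The principal `𝔰𝔩₂` and the sizes of the levels -/

section PrincipalRaising

open Matrix

variable {n : ℕ}

open Classical in
/-- The raising operator of color `i` on the span of the words. -/
noncomputable def raising (i : Fin n) : Matrix (SpinWord n) (SpinWord n) ℝ :=
  Matrix.of fun u w => if spinEdge w i u then 1 else 0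

theorem raising_mul_transpose (i j : Fin n) (u v : SpinWord n) [Decidable
    (spinWt u i = 1 ∧ spinEdge (toggle i u) j v)] :
    (raising i * (raising j)ᵀ) u v =
      if spinWt u i = 1 ∧ spinEdge (toggle i u) j v then 1 else 0 := by
  classical
  simp only [Matrix.mul_apply, raising, Matrix.of_apply, Matrix.transpose_apply]
  rw [Finset.sum_eq_single (toggle i u)]
  · have : spinEdge (toggle i u) i u ↔ spinWt u i = 1 := by rw [spinEdge_iff_target]; simp
    simp only [this]
    split_ifs <;> simp_all
  · intro w _ hw
    rw [if_neg, zero_mul]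
    rw [spinEdge_iff_target]
    exact fun h => hw h.2
  · simp

theorem transpose_mul_raising (i j : Fin n) (u v : SpinWord n) [Decidable
    (spinWt u j = -1 ∧ spinEdge v i (toggle j u))] :
    ((raising j)ᵀ * raising i) u v =
      if spinWt u j = -1 ∧ spinEdge v i (toggle j u) then 1 else 0 := by
  classical
  simp only [Matrix.mul_apply, raising, Matrix.of_apply, Matrix.transpose_apply]
  rw [Finset.sum_eq_single (toggle j u)]
  · have : spinEdge u j (toggle j u) ↔ spinWt u j = -1 := by rw [spinEdge_iff_source]; simp
    simp only [this]
    split_ifs <;> simp_all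
  · intro w _ hw
    rw [if_neg, zero_mul]
    rw [spinEdge_iff_source]
    exact fun h => hw h.2
  · simp

/-- For `i = j` both products are diagonal projections, onto the words of weight `1` and of weight
`-1`. For `i ≠ j` the two products agree entry by entry because diamonds complete
(`spinEdge_diamond`). -/
theorem raising_commutator (i j : Fin n) :
    raising i * (raising j)ᵀ - (raising j)ᵀ * raising i =
      if i = j then Matrix.diagonal fun t => (spinWt t i : ℝ) else 0 := by
  classical
  ext u v
  rw [Matrix.sub_apply, raising_mul_transpose, transpose_mul_raising]
  by_cases hij : i = j
  · subst hij
    rw [if_pos rfl, Matrix.diagonal_apply, spinEdge_iff_source, spinEdge_iff_target,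
      spinWt_toggle, toggle_toggle]
    by_cases huv : u = v
    · subst huv
      rcases spinWt_trichotomy u i with h | h | h <;> simp [h]
    · simp [huv, Ne.symm huv]
  · rw [if_neg hij, if_congr (spinEdge_diamond hij u v) rfl rfl, sub_self, Matrix.zero_apply]

/-- The raising operator of the principal `𝔰𝔩₂`, scaled so that its transpose is the lowering
operator. -/
noncomputable def principalRaising (n : ℕ) : Matrix (SpinWord n) (SpinWord n) ℝ :=
  ∑ i : Fin n, Real.sqrt (principalCoeff i) • raising i

/-- The cross terms vanish, and the square roots recombine to the nonnegative coefficients of the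
grading element. -/
theorem principalRaising_commutator :
    principalRaising n * (principalRaising n)ᵀ - (principalRaising n)ᵀ * principalRaising n =
      Matrix.diagonal fun t => 2 * (spinRank t : ℝ) - spinLength n := by
  have h : ∀ i j : Fin n,
      (√(principalCoeff i : ℝ) • raising i) * (√(principalCoeff j : ℝ) • (raising j)ᵀ) -
        (√(principalCoeff j : ℝ) • (raising j)ᵀ) * (√(principalCoeff i : ℝ) • raising i) =
      if i = j then Matrix.diagonal fun t => (principalCoeff i : ℝ) * spinWt t i else 0 := by
    intro i j
    rw [smul_mul_smul_comm, smul_mul_smul_comm, mul_comm √(principalCoeff j : ℝ), ← smul_sub,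
      raising_commutator]
    split_ifs with hij
    · subst hij
      rw [Real.mul_self_sqrt (Nat.cast_nonneg _), ← Matrix.diagonal_smul]
      rfl
    · simp
  simp only [principalRaising, Matrix.transpose_sum, Matrix.transpose_smul]
  rw [Finset.sum_mul_sum, Finset.sum_mul_sum, Finset.sum_comm (s := Finset.univ),
    ← Finset.sum_sub_distrib]
  simp_rw [← Finset.sum_sub_distrib, h]
  ext u v
  simp only [Finset.sum_ite_eq', Finset.mem_univ, if_true, Matrix.sum_apply,
    Matrix.diagonal_apply]
  by_cases huv : u = v
  · subst huv
    simp only [if_true]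
    exact_mod_cast sum_principalCoeff_mul_spinWt u
  · simp [huv]

theorem principalRaising_apply_eq_zero {u w : SpinWord n} (h : spinRank u ≠ spinRank w + 1) :
    principalRaising n u w = 0 := by
  rw [principalRaising, Matrix.sum_apply]
  refine Finset.sum_eq_zero fun i _ => ?_
  rw [Matrix.smul_apply, raising, Matrix.of_apply, if_neg, smul_zero]
  exact fun he => h (spinRank_of_spinEdge he)

/-- If `E f = 0` then `‖Eᵀ f‖² = ⟨f, [E, Eᵀ] f⟩ = (2k - length) ‖f‖²`, and the factor is negative.
-/
theorem eq_zero_of_principalRaising_mulVec_eq_zero {k : ℕ} (hk : 2 * k < spinLength n)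
    {f : SpinWord n → ℝ} (hf : ∀ t, spinRank t ≠ k → f t = 0)
    (h : principalRaising n *ᵥ f = 0) : f = 0 := by
  have h1 := congrArg (fun A => f ⬝ᵥ (A *ᵥ f)) (principalRaising_commutator (n := n))
  simp only [Matrix.sub_mulVec, ← Matrix.mulVec_mulVec, h, Matrix.mulVec_zero, sub_zero] at h1
  rw [Matrix.dotProduct_mulVec, ← Matrix.mulVec_transpose] at h1
  have h2 : f ⬝ᵥ (Matrix.diagonal (fun t => 2 * (spinRank t : ℝ) - spinLength n) *ᵥ f) =
      (2 * (k : ℝ) - spinLength n) * (f ⬝ᵥ f) := by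
    simp only [dotProduct, Matrix.mulVec_diagonal, Finset.mul_sum]
    refine Finset.sum_congr rfl fun t _ => ?_
    by_cases ht : spinRank t = k
    · rw [ht]; ring
    · rw [hf t ht]; ring
  have h3 : 0 ≤ ((principalRaising n)ᵀ *ᵥ f) ⬝ᵥ ((principalRaising n)ᵀ *ᵥ f) :=
    Finset.sum_nonneg fun t _ => mul_self_nonneg _
  have h4 : 0 ≤ f ⬝ᵥ f := Finset.sum_nonneg fun t _ => mul_self_nonneg _
  have hk' : (2 * (k : ℝ)) < spinLength n := by exact_mod_cast hk
  rw [h1, h2] at h3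
  have h5 : f ⬝ᵥ f = 0 := by nlinarith
  exact dotProduct_self_eq_zero.1 h5

/-- The number of words of rank `k`. -/
def levelCard (n k : ℕ) : ℕ := Fintype.card {t : SpinWord n // spinRank t = k}

theorem levelCard_le_succ {k : ℕ} (hk : 2 * k < spinLength n) :
    levelCard n k ≤ levelCard n (k + 1) := by
  let L : ({t : SpinWord n // spinRank t = k} → ℝ) →ₗ[ℝ]
      ({t : SpinWord n // spinRank t = k + 1} → ℝ) :=
    Matrix.mulVecLin ((principalRaising n).submatrix (fun t => t.1) (fun t => t.1))
  have hL : Function.Injective L := by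
    rw [← LinearMap.ker_eq_bot, LinearMap.ker_eq_bot']
    intro v hv
    let f : SpinWord n → ℝ := fun t => if h : spinRank t = k then v ⟨t, h⟩ else 0
    have hfv : ∀ t : {t : SpinWord n // spinRank t = k}, f t = v t := fun t => by simp [f, t.2]
    have hsum : ∀ u, (principalRaising n *ᵥ f) u =
        ∑ t : {t : SpinWord n // spinRank t = k}, principalRaising n u t * v t := by
      intro u
      simp only [Matrix.mulVec, dotProduct]
      rw [← Finset.sum_subset (Finset.subset_univ (Finset.univ.filter fun t => spinRank t = k))]
      · rw [← Finset.sum_subtype_eq_sum_filter]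
        simp_rw [← hfv]
        simp
      · intro t _ ht
        have : f t = 0 := by simpa [f] using fun h => absurd h (by simpa using ht)
        rw [this, mul_zero]
    have hf : f = 0 := by
      apply eq_zero_of_principalRaising_mulVec_eq_zero hk
      · intro t ht; simp [f, ht]
      · funext u
        rw [hsum]
        -- The block `L` sees only level `k + 1`, but `E` raises rank by exactly one, so the image
        -- of `f` has no other components.
        by_cases hu : spinRank u = k + 1
        · exact congrFun hv ⟨u, hu⟩
        · refine Finset.sum_eq_zero fun t _ => ?_
          rw [principalRaising_apply_eq_zero (by rw [t.2]; exact hu), zero_mul]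
    funext t
    rw [← hfv, hf]; rfl
  have := LinearMap.finrank_le_finrank_of_injective hL
  simpa [levelCard, Module.finrank_fintype_fun_eq_card] using this

theorem levelCard_symm {k : ℕ} (hk : k ≤ spinLength n) :
    levelCard n k = levelCard n (spinLength n - k) := by
  refine Fintype.card_congr ⟨fun t => ⟨fun j => !t.1 j, ?_⟩, fun t => ⟨fun j => !t.1 j, ?_⟩, ?_, ?_⟩
  · have := spinRank_compl t.1
    have := t.2
    omega
  · have := spinRank_compl t.1
    have := t.2
    omega
  · intro t; simp
  · intro t; simp

theorem levelCard_eq_zero {k : ℕ} (hk : spinLength n < k) : levelCard n k = 0 := by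
  rw [levelCard, Fintype.card_eq_zero_iff]
  exact ⟨fun t => by have := spinRank_le t.1; have := t.2; omega⟩

theorem levelCard_succ_le {k : ℕ} (hk : spinLength n < 2 * (k + 1)) :
    levelCard n (k + 1) ≤ levelCard n k := by
  rcases Nat.lt_or_ge (spinLength n) (k + 1) with h | h
  · rw [levelCard_eq_zero h]; exact Nat.zero_le _
  · rw [levelCard_symm h, levelCard_symm (k := k) (by omega)]
    have := levelCard_le_succ (n := n) (k := spinLength n - (k + 1)) (by omega)
    rwa [show spinLength n - (k + 1) + 1 = spinLength n - k by omega] at this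

end PrincipalRaising

/-! ### The rank generating function -/

section RankGeneratingFunction

variable {n : ℕ}

theorem coeff_rankGenFun_spinRank (k : ℕ) :
    (rankGenFun (spinRank (n := n))).coeff k = levelCard n k := by
  rw [rankGenFun, finsetSum_coeff, levelCard, Fintype.card_subtype]
  simp [coeff_X_pow, eq_comm]

theorem natDegree_rankGenFun_spinRank :
    (rankGenFun (spinRank (n := n))).natDegree = spinLength n := by
  refine natDegree_eq_of_le_of_coeff_ne_zero ?_ ?_
  · rw [natDegree_le_iff_coeff_eq_zero]
    intro k hk
    rw [coeff_rankGenFun_spinRank, levelCard_eq_zero hk, Nat.cast_zero]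
  · rw [coeff_rankGenFun_spinRank, Nat.cast_ne_zero]
    exact (Fintype.card_pos_iff.2 ⟨⟨_, spinRank_top⟩⟩).ne'

theorem isSymmetricPoly_rankGenFun_spinRank :
    IsSymmetricPoly (rankGenFun (spinRank (n := n))) := by
  intro k hk
  rw [natDegree_rankGenFun_spinRank] at *
  rw [coeff_rankGenFun_spinRank, coeff_rankGenFun_spinRank, levelCard_symm hk]

theorem isUnimodalPoly_rankGenFun_spinRank :
    IsUnimodalPoly (rankGenFun (spinRank (n := n))) := by
  refine ⟨spinLength n / 2, ?_, ?_⟩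
  · refine monotoneOn_of_le_add_one Set.ordConnected_Iic fun k _ _ hk => ?_
    rw [coeff_rankGenFun_spinRank, coeff_rankGenFun_spinRank, Nat.cast_le]
    exact levelCard_le_succ (by rw [Set.mem_Iic] at hk; omega)
  · refine antitoneOn_of_add_one_le Set.ordConnected_Ici fun k _ hk _ => ?_
    rw [coeff_rankGenFun_spinRank, coeff_rankGenFun_spinRank, Nat.cast_le]
    exact levelCard_succ_le (by rw [Set.mem_Ici] at hk; omega)

/-- Expanding the product chooses a bit for each factor, and the bit at `i` contributes `n - i` to
the rank. -/
theorem rankGenFun_spinRank_eq_prod :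
    rankGenFun (spinRank (n := n)) = ∏ i ∈ Finset.Icc 1 n, (1 + X ^ i) := by
  have h1 : ∏ i ∈ Finset.Icc 1 n, (1 + X ^ i : ℤ[X]) = ∏ i : Fin n, (1 + X ^ (n - i)) := by
    rw [Fin.prod_univ_eq_prod_range (fun i => (1 + X ^ (n - i) : ℤ[X])) n]
    refine Finset.prod_nbij' (fun i => n - i) (fun i => n - i) ?_ ?_ ?_ ?_ ?_
    all_goals
      intro i hi
      simp only [Finset.mem_Icc, Finset.mem_range] at *
    · omega
    · omega
    · omega
    · omega
    · rw [show n - (n - i) = i by omega]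
  have h2 : ∀ i : Fin n, (1 + X ^ (n - i) : ℤ[X]) = ∑ b : Bool, X ^ ((n - i) * b.toNat) := by
    intro i; simp [add_comm]
  rw [h1, Finset.prod_congr rfl fun i _ => h2 i, Finset.prod_univ_sum, Fintype.piFinset_univ,
    rankGenFun]
  refine Finset.sum_congr rfl fun t _ => ?_
  rw [Finset.prod_pow_eq_pow_sum, spinRank_eq_sum]
  simp_rw [bit_coe]

end RankGeneratingFunction

/-! ### Initial and final segments of `Fin n` are determined by their size -/

section Segments

variable {n : ℕ}

theorem iff_lt_card_filter {Q : Fin n → Prop} [DecidablePred Q]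
    (hQ : ∀ a b, a ≤ b → Q b → Q a) (k : Fin n) :
    Q k ↔ (k : ℕ) < (Finset.univ.filter Q).card := by
  constructor
  · intro hk
    have : Finset.Iic k ⊆ Finset.univ.filter Q := by
      intro j hj
      simpa using hQ j k (Finset.mem_Iic.1 hj) hk
    have := Finset.card_le_card this
    rw [Fin.card_Iic] at this
    omega
  · contrapose
    intro hk
    have : Finset.univ.filter Q ⊆ Finset.Iio k := by
      intro j hj
      rw [Finset.mem_Iio]
      by_contra hjk
      exact hk (hQ k j (not_lt.1 hjk) (by simpa using hj))
    have := Finset.card_le_card this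
    rw [Fin.card_Iio] at this
    omega

theorem iff_sub_le_card_filter {Q : Fin n → Prop} [DecidablePred Q]
    (hQ : ∀ a b, a ≤ b → Q a → Q b) (k : Fin n) :
    Q k ↔ n - (k : ℕ) ≤ (Finset.univ.filter Q).card := by
  constructor
  · intro hk
    have : Finset.Ici k ⊆ Finset.univ.filter Q := by
      intro j hj
      simpa using hQ k j (Finset.mem_Ici.1 hj) hk
    have := Finset.card_le_card this
    rwa [Fin.card_Ici] at this
  · contrapose
    intro hk
    have : Finset.univ.filter Q ⊆ Finset.Ioi k := by
      intro j hj
      rw [Finset.mem_Ioi]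
      by_contra hjk
      exact hk (hQ j k (not_lt.1 hjk) (by simpa using hj))
    have := Finset.card_le_card this
    rw [Fin.card_Ioi] at this
    omega

theorem card_filter_lt {m : ℕ} (h : m ≤ n) :
    (Finset.univ.filter fun k : Fin n => (k : ℕ) < m).card = m := by
  rw [Fin.card_filter_val_lt, min_eq_right h]

theorem card_filter_sub_le {m : ℕ} (h : m ≤ n) :
    (Finset.univ.filter fun i : Fin n => n - (i : ℕ) ≤ m).card = m := by
  have := Finset.card_filter_add_card_filter_not (s := (Finset.univ : Finset (Fin n)))
    (fun i => (i : ℕ) < n - m)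
  rw [card_filter_lt (Nat.sub_le n m), Finset.card_univ, Fintype.card_fin] at this
  have h' : (Finset.univ.filter fun i : Fin n => n - (i : ℕ) ≤ m) =
      Finset.univ.filter fun i : Fin n => ¬ (i : ℕ) < n - m := by
    ext i; simp only [Finset.mem_filter, Finset.mem_univ, true_and]; omega
  rw [h']
  omega

end Segments

/-! ### The lattice `𝒵(n)` as the spin lattice -/

section ZeroCushionedWords

variable {n : ℕ}

theorem ZeroCushioned.lt_of_lt (s : ZeroCushioned n) {i j : Fin n} (hij : i < j)
    (h : s.1 i ≠ 0) : s.1 j < s.1 i := by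
  have h1 : (i : ℕ) + 1 < n := by omega
  have h2 : (⟨i + 1, h1⟩ : Fin n) ≤ j := hij
  exact lt_of_le_of_lt (s.2.2.1 h2) (s.2.2.2 i ⟨i + 1, h1⟩ rfl h)

theorem ZeroCushioned.eq_of_apply_eq (s : ZeroCushioned n) {i j : Fin n} (h : s.1 i = s.1 j)
    (h0 : s.1 i ≠ 0) : i = j := by
  rcases lt_trichotomy i j with hij | hij | hij
  · have := s.lt_of_lt hij h0; omega
  · exact hij
  · have := s.lt_of_lt hij (h ▸ h0); omega

/-- The number of entries that are at least `n - i`. -/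
def upperCount (s : ZeroCushioned n) (i : ℕ) : ℕ :=
  (Finset.univ.filter fun k : Fin n => n - i ≤ s.1 k).card

theorem lt_upperCount_iff (s : ZeroCushioned n) (i k : Fin n) :
    (k : ℕ) < upperCount s i ↔ n - (i : ℕ) ≤ s.1 k :=
  (iff_lt_card_filter (Q := fun k => n - (i : ℕ) ≤ s.1 k)
    (fun _ _ hab h => h.trans (s.2.2.1 hab)) k).symm

/-- This is conjugation of partitions: a weakly decreasing sequence is recovered from the counts of
its entries above each threshold. -/
theorem apply_eq_card_upperCount (s : ZeroCushioned n) (k : Fin n) :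
    s.1 k = (Finset.univ.filter fun i : Fin n => (k : ℕ) < upperCount s i).card := by
  simp_rw [lt_upperCount_iff]
  exact (card_filter_sub_le (s.2.1 k)).symm

/-- The word of a zero-cushioned sequence: position `i` tells whether the value `n - i`
occurs. -/
def toWord (s : ZeroCushioned n) : SpinWord n := fun i => decide (∃ k, s.1 k = n - i)

/-- A nonzero value occurs at most once in a zero-cushioned sequence, so presence and multiplicity
coincide. -/
theorem bit_toWord (s : ZeroCushioned n) {i : ℕ} (hi : i < n) :
    bit (toWord s) i = (Finset.univ.filter fun k : Fin n => s.1 k = n - i).card := by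
  simp only [bit, dif_pos hi, toWord]
  by_cases h : ∃ k, s.1 k = n - i
  · obtain ⟨k, hk⟩ := h
    have : (Finset.univ.filter fun k : Fin n => s.1 k = n - i) = {k} := by
      ext j
      simp only [Finset.mem_filter, Finset.mem_univ, true_and, Finset.mem_singleton]
      constructor
      · intro hj; exact s.eq_of_apply_eq (hj.trans hk.symm) (by omega)
      · rintro rfl; exact hk
    rw [this, Finset.card_singleton]
    simp [show ∃ k, s.1 k = n - i from ⟨k, hk⟩]
  · have : (Finset.univ.filter fun k : Fin n => s.1 k = n - i) = ∅ := by
      ext j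
      simpa using fun hj => h ⟨j, hj⟩
    rw [this, Finset.card_empty]
    simpa using h

theorem height_toWord (s : ZeroCushioned n) {i : ℕ} (hi : i < n) :
    height (toWord s) i = upperCount s i := by
  induction i with
  | zero =>
    rw [height_zero, bit_toWord s hi, upperCount]
    congr 1
    ext k
    have := s.2.1 k
    simp only [Finset.mem_filter, Finset.mem_univ, true_and]
    omega
  | succ i ih =>
    rw [height_succ, ih (by omega), bit_toWord s hi, upperCount, upperCount,
      ← Finset.card_union_of_disjoint]
    · congr 1
      ext k
      simp only [Finset.mem_filter, Finset.mem_univ, true_and, Finset.mem_union]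
      omega
    · rw [Finset.disjoint_filter]
      intro k _ h1 h2
      omega

theorem toWord_injective : Function.Injective (toWord (n := n)) := by
  intro s t h
  refine Subtype.ext (funext fun k => ?_)
  rw [apply_eq_card_upperCount, apply_eq_card_upperCount]
  congr 1
  ext i
  rw [Finset.mem_filter, Finset.mem_filter, ← height_toWord s i.2, ← height_toWord t i.2, h]

/-- The zero-cushioned sequence of a word. -/
def ofWord (t : SpinWord n) : ZeroCushioned n := by
  refine ⟨fun k => (Finset.univ.filter fun i : Fin n => (k : ℕ) < height t i).card, ?_, ?_, ?_⟩
  · intro k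
    exact (Finset.card_le_univ _).trans_eq (Fintype.card_fin n)
  · intro k l hkl
    refine Finset.card_le_card fun i hi => ?_
    simp only [Finset.mem_filter, Finset.mem_univ, true_and] at hi ⊢
    exact lt_of_le_of_lt hkl hi
  · intro k l hkl hk
    refine Finset.card_lt_card ⟨fun i hi => ?_, fun hsub => ?_⟩
    · simp only [Finset.mem_filter, Finset.mem_univ, true_and] at hi ⊢
      omega
    · obtain ⟨i, hi⟩ := Finset.card_ne_zero.1 hk
      simp only [Finset.mem_filter, Finset.mem_univ, true_and] at hi
      -- If the two counts agreed, every height above `k` would exceed `k + 1`. Heights grow by at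
      -- most one per position, so this would propagate back to position `0`, where the height is at
      -- most `1`.
      have key : ∀ j : ℕ, j < n → (k : ℕ) < height t j → False := by
        intro j
        induction j with
        | zero =>
          intro hj h
          have h1 := hsub (Finset.mem_filter.2 ⟨Finset.mem_univ (⟨0, hj⟩ : Fin n), h⟩)
          simp only [Finset.mem_filter, Finset.mem_univ, true_and] at h1
          have := height_le t 0
          omega
        | succ j ih =>
          intro hj h
          have h1 := hsub (Finset.mem_filter.2 ⟨Finset.mem_univ (⟨j + 1, hj⟩ : Fin n), h⟩)
          simp only [Finset.mem_filter, Finset.mem_univ, true_and] at h1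
          rw [height_succ] at h1
          have := bit_le_one t (j + 1)
          exact ih (by omega) (by omega)
      exact key i i.2 hi

theorem toWord_ofWord (t : SpinWord n) : toWord (ofWord t) = t := by
  refine height_injective fun i => ?_
  rw [height_toWord _ i.2, upperCount]
  have : ∀ k : Fin n, n - (i : ℕ) ≤ (ofWord t).1 k ↔ (k : ℕ) < height t i := fun k =>
    (iff_sub_le_card_filter (Q := fun i : Fin n => (k : ℕ) < height t i)
      (fun _ _ hab h => h.trans_le (height_mono t hab)) i).symm
  simp_rw [this]
  exact card_filter_lt ((height_le t i).trans i.2)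

/-- Zero-cushioned sequences correspond to words. -/
def wordEquiv (n : ℕ) : ZeroCushioned n ≃ SpinWord n where
  toFun := toWord
  invFun := ofWord
  left_inv _ := toWord_injective (toWord_ofWord _)
  right_inv := toWord_ofWord

theorem covBy_of_add_one {s t : ZeroCushioned n} {k : Fin n} (hk : t.1 k = s.1 k + 1)
    (h : ∀ j, j ≠ k → t.1 j = s.1 j) : s ⋖ t := by
  refine ⟨⟨fun j => ?_, fun hts => ?_⟩, fun r hsr hrt => ?_⟩
  · by_cases hj : j = k
    · subst hj; change s.1 j ≤ t.1 j; omega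
    · exact (h j hj).ge
  · have : t.1 k ≤ s.1 k := hts k; omega
  · have h1 : ∀ j, s.1 j ≤ r.1 j := hsr.le
    have h2 : ∀ j, r.1 j ≤ t.1 j := hrt.le
    have h3 : ∀ j, j ≠ k → r.1 j = s.1 j := fun j hj => le_antisymm (h j hj ▸ h2 j) (h1 j)
    rcases Nat.lt_or_ge (s.1 k) (r.1 k) with hlt | hge
    · refine hrt.not_ge fun j => ?_
      by_cases hj : j = k
      · subst hj; change t.1 j ≤ r.1 j; omega
      · exact (h j hj).trans_le (h1 j)
    · refine hsr.not_ge fun j => ?_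
      by_cases hj : j = k
      · subst hj; exact hge
      · exact (h3 j hj).le

/-- Below a larger sequence, the first differing entry can be raised by one. -/
theorem exists_add_one_le {s t : ZeroCushioned n} (h : s < t) :
    ∃ r : ZeroCushioned n, r ≤ t ∧ ∃ k, r.1 k = s.1 k + 1 ∧ ∀ j, j ≠ k → r.1 j = s.1 j := by
  classical
  have hle : ∀ j, s.1 j ≤ t.1 j := h.le
  have hex : ∃ k, s.1 k < t.1 k := by
    by_contra! hne
    exact h.not_ge hne
  obtain ⟨k, hk, hmin⟩ : ∃ k, s.1 k < t.1 k ∧ ∀ j < k, s.1 j = t.1 j := by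
    obtain ⟨k, hk, hmin⟩ := WellFounded.has_min (wellFounded_lt (α := Fin n))
      {k | s.1 k < t.1 k} hex
    exact ⟨k, hk, fun j hj => le_antisymm (hle j) (not_lt.1 fun h' => hmin j h' hj)⟩
  have hr : ∀ j, (Function.update s.1 k (s.1 k + 1)) j ≤ t.1 j := by
    intro j
    by_cases hj : j = k
    · subst hj; rw [Function.update_self]; omega
    · rw [Function.update_of_ne hj]; exact hle j
  -- Before the first difference `s` agrees with `t`, whose strict decrease leaves room to raise
  -- entry `k`.
  have hlt : ∀ j < k, s.1 k + 1 < s.1 j := by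
    intro j hj
    have h0 : t.1 j ≠ 0 := by have := t.2.2.1 hj.le; omega
    have := t.lt_of_lt hj h0
    rw [hmin j hj]; omega
  refine ⟨⟨Function.update s.1 k (s.1 k + 1), fun j => (hr j).trans (t.2.1 j), ?_, ?_⟩, hr, k,
    Function.update_self .., fun j hj => Function.update_of_ne hj ..⟩
  · intro i j hij
    have hs := s.2.2.1 hij
    by_cases hi : i = k
    · subst hi
      by_cases hj : j = i
      · subst hj; exact le_rfl
      · rw [Function.update_self, Function.update_of_ne hj]; omega
    · by_cases hj : j = k
      · subst hj
        rw [Function.update_self, Function.update_of_ne hi]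
        exact (hlt i (lt_of_le_of_ne hij hi)).le
      · rwa [Function.update_of_ne hj, Function.update_of_ne hi]
  · intro i j hij h0
    have hlt' : i < j := by rw [Fin.lt_def]; omega
    by_cases hi : i = k
    · subst hi
      rw [Function.update_self, Function.update_of_ne hlt'.ne']
      have := s.2.2.1 hlt'.le
      omega
    · rw [Function.update_of_ne hi] at h0 ⊢
      by_cases hj : j = k
      · subst hj
        rw [Function.update_self]; exact hlt i hlt'
      · rw [Function.update_of_ne hj]; exact s.2.2.2 i j hij h0

theorem covBy_iff_exists_add_one {s t : ZeroCushioned n} :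
    s ⋖ t ↔ ∃ k, t.1 k = s.1 k + 1 ∧ ∀ j, j ≠ k → t.1 j = s.1 j := by
  constructor
  · intro h
    obtain ⟨r, hrt, k, hk, hj⟩ := exists_add_one_le h.lt
    obtain rfl : r = t := (h.eq_or_eq (covBy_of_add_one hk hj).lt.le hrt).resolve_left
      (covBy_of_add_one hk hj).lt.ne'
    exact ⟨k, hk, hj⟩
  · rintro ⟨k, hk, hj⟩
    exact covBy_of_add_one hk hj

theorem isOrderDiagram_zeroCushionedEdge : IsOrderDiagram (zeroCushionedEdge n) := by
  refine ⟨fun s i t h => h.1, fun s t h => ?_⟩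
  obtain ⟨k, hk, hj⟩ := covBy_iff_exists_add_one.1 h
  have h1 := t.2.1 k
  refine ⟨⟨n - t.1 k, by omega⟩, ⟨h, k, hk, hj, by simp; omega⟩, ?_⟩
  rintro i ⟨-, k', hk', hj', hi⟩
  obtain rfl : k' = k := by
    by_contra hne
    have := hj k' hne
    omega
  ext
  simp only
  omega

/-- The sequences are closed under componentwise maximum and minimum. For the maximum, weak decrease
covers the case where just one of the two entries is zero. -/
theorem isDistributiveLatticeOrder_zeroCushioned : IsDistributiveLatticeOrder (ZeroCushioned n) := by
  let L : Lattice (ZeroCushioned n) := Subtype.lattice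
    (fun {s t} hs ht => ⟨fun i => sup_le (hs.1 i) (ht.1 i), fun i j hij =>
        sup_le_sup (hs.2.1 hij) (ht.2.1 hij), fun i j hij h0 => by
      have h1 := hs.2.2 i j hij
      have h2 := ht.2.2 i j hij
      have hij' : i ≤ j := by rw [Fin.le_def]; omega
      have h3 := hs.2.1 hij'
      have h4 := ht.2.1 hij'
      simp only [Pi.sup_apply] at h0 ⊢
      omega⟩)
    (fun {s t} hs ht => ⟨fun i => inf_le_left.trans (hs.1 i), fun i j hij =>
        inf_le_inf (hs.2.1 hij) (ht.2.1 hij), fun i j hij h0 => by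
      have h1 := hs.2.2 i j hij
      have h2 := ht.2.2 i j hij
      simp only [Pi.inf_apply] at h0 ⊢
      omega⟩)
  refine ⟨DistribLattice.ofInfSupLe fun a b c => ?_, fun a b => Iff.rfl⟩
  intro i
  exact (inf_sup_left (a.1 i) (b.1 i) (c.1 i)).le

/-- Raising an entry to `n - i` changes only the count of entries that are at least `n - i`, and
that count is the height at `i`. -/
theorem isSpinIso_zeroCushionedEdge : IsSpinIso (zeroCushionedEdge n) (wordEquiv n) := by
  intro s i t
  change _ ↔ spinEdge (toWord s) i (toWord t)
  rw [spinEdge_iff_height]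
  constructor
  · rintro ⟨-, k, hk, hj, hi⟩ j
    rw [height_toWord s j.2, height_toWord t j.2]
    by_cases hji : j = i
    · subst hji
      rw [if_pos rfl, upperCount, upperCount, ← Finset.card_insert_of_notMem (a := k)]
      · congr 1
        ext l
        by_cases hl : l = k
        · subst hl; simp; omega
        · simp [hj l hl, hl]
      · simp; omega
    · rw [if_neg hji, add_zero, upperCount, upperCount]
      congr 1
      ext l
      by_cases hl : l = k
      · subst hl
        have : (j : ℕ) ≠ i := fun e => hji (Fin.ext e)
        simp only [Finset.mem_filter, Finset.mem_univ, true_and]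
        omega
      · simp [hj l hl]
  · intro h
    have hup : ∀ j : Fin n, upperCount t j = upperCount s j + if j = i then 1 else 0 := by
      intro j
      rw [← height_toWord s j.2, ← height_toWord t j.2, h]
    -- The entry to be raised is the first one below `n - i`; counting from `0`, its position is
    -- `upperCount s i`.
    have hkn : upperCount s i < n := by
      have h1 := hup i
      rw [if_pos rfl] at h1
      have h2 : upperCount t i ≤ n := (Finset.card_le_univ _).trans_eq (Fintype.card_fin n)
      omega
    have hk : t.1 ⟨upperCount s i, hkn⟩ = s.1 ⟨upperCount s i, hkn⟩ + 1 := by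
      rw [apply_eq_card_upperCount, apply_eq_card_upperCount,
        ← Finset.card_insert_of_notMem (a := i)]
      · congr 1
        ext j
        simp only [Finset.mem_filter, Finset.mem_univ, true_and, Finset.mem_insert, hup]
        by_cases hji : j = i
        · subst hji; simp
        · simp [hji]
      · simp
    have hj : ∀ j, j ≠ ⟨upperCount s i, hkn⟩ → t.1 j = s.1 j := by
      intro j hj
      rw [apply_eq_card_upperCount, apply_eq_card_upperCount]
      congr 1
      ext l
      simp only [Finset.mem_filter, Finset.mem_univ, true_and, hup]
      by_cases hli : l = i
      · subst hli
        have : (j : ℕ) ≠ upperCount s l := fun e => hj (Fin.ext e)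
        rw [if_pos rfl]; omega
      · simp [hli]
    refine ⟨covBy_of_add_one hk hj, _, hk, hj, ?_⟩
    have h1 := (lt_upperCount_iff s i ⟨upperCount s i, hkn⟩).not.1 (lt_irrefl _)
    have h2 := (lt_upperCount_iff t i ⟨upperCount s i, hkn⟩).1 (by rw [hup]; simp)
    omega

theorem spinRank_of_covBy {s t : ZeroCushioned n} (h : s ⋖ t) :
    spinRank (toWord s) + 1 = spinRank (toWord t) := by
  obtain ⟨i, hi, -⟩ := isOrderDiagram_zeroCushionedEdge.2 s t h
  exact (spinRank_of_spinEdge ((isSpinIso_zeroCushionedEdge s i t).1 hi)).symm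

theorem exists_covBy_of_spinRank_pos {t : ZeroCushioned n} (h : 0 < spinRank (toWord t)) :
    ∃ s, s ⋖ t := by
  obtain ⟨i, hi⟩ : ∃ i, spinWt (toWord t) i = 1 := by
    by_contra! hne
    have : ∀ i, toWord t i = false := by
      refine eq_of_next_of_last ?_ ?_
      · intro i j hij hj
        by_contra hi
        refine hne i ((spinWt_eq_one_iff _ i).2 ⟨by simpa using hi, fun k hk => ?_⟩)
        rwa [show k = j from Fin.ext (by omega)]
      · intro j _
        by_contra hi
        exact hne j ((spinWt_eq_one_iff _ j).2 ⟨by simpa using hi, fun k hk => by omega⟩)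
    rw [spinRank_eq_sum] at h
    simp [bit_coe, this] at h
  refine ⟨(wordEquiv n).symm (toggle i (toWord t)), ((isSpinIso_zeroCushionedEdge _ i t).2 ?_).1⟩
  rw [Equiv.apply_symm_apply, spinEdge_iff_target]
  exact ⟨hi, rfl⟩

theorem isRankFunction_spinRank :
    IsRankFunction (fun s : ZeroCushioned n => spinRank (toWord s)) (spinLength n) := by
  refine ⟨?_, fun s _ t _ h => spinRank_of_covBy h⟩
  ext k
  rw [Set.image_univ, Set.mem_range, Set.mem_Iic]
  constructor
  · rintro ⟨s, rfl⟩; exact spinRank_le _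
  · intro hk
    induction hk using Nat.decreasingInduction with
    | self => exact ⟨ofWord fun _ => true, by rw [toWord_ofWord, spinRank_top]⟩
    | of_succ k hk ih =>
      obtain ⟨t, ht⟩ := ih
      obtain ⟨s, hs⟩ := exists_covBy_of_spinRank_pos (t := t) (by omega)
      have := spinRank_of_covBy hs
      exact ⟨s, by omega⟩

/-- Descending along covers to the zero word shows that the two functions differ by a constant; both
are nonnegative and `ρ` attains `0`, so the constant is `0`. -/
theorem eq_spinRank_of_isRankFunction {ρ : ZeroCushioned n → ℕ} {l : ℕ} (h : IsRankFunction ρ l)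
    (s : ZeroCushioned n) : ρ s = spinRank (toWord s) := by
  have key : ∀ (k : ℕ) (s : ZeroCushioned n), spinRank (toWord s) = k →
      ρ s = ρ (ofWord fun _ => false) + k := by
    intro k
    induction k with
    | zero =>
      intro s hs
      have : toWord s = fun _ => false := by
        refine spinWord_ext fun i => ?_
        rw [spinRank_eq_sum, Finset.sum_eq_zero_iff] at hs
        have h1 := hs i (Finset.mem_univ i)
        have h2 := (Nat.mul_eq_zero.1 h1).resolve_left (by omega)
        rw [h2, bit_coe]; rfl
      rw [← this]
      simp only [add_zero]
      exact congrArg ρ ((wordEquiv n).symm_apply_apply s).symm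
    | succ k ih =>
      intro s hs
      obtain ⟨r, hr⟩ := exists_covBy_of_spinRank_pos (t := s) (by omega)
      have h1 := spinRank_of_covBy hr
      have h2 := h.2 r (Set.mem_univ _) s (Set.mem_univ _) hr
      have h3 := ih r (by omega)
      omega
  obtain ⟨r, -, hr⟩ : 0 ∈ ρ '' Set.univ := by rw [h.1]; simp
  have h1 := key _ r rfl
  have h2 := key _ s rfl
  omega

theorem rankGenFun_of_isRankFunction {ρ : ZeroCushioned n → ℕ} {l : ℕ} (h : IsRankFunction ρ l) :
    rankGenFun ρ = rankGenFun (spinRank (n := n)) := by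
  unfold rankGenFun
  simp_rw [eq_spinRank_of_isRankFunction h]
  exact (wordEquiv n).sum_comp fun t => (X : ℤ[X]) ^ spinRank t

theorem isSplitting_zeroCushioned :
    IsDiamondColoredSplittingDistributiveLattice (CartanMatrix.B n) (zeroCushionedEdge n)
      (spinCharacter n) where
  orderDiagram := isOrderDiagram_zeroCushionedEdge
  distributive := isDistributiveLatticeOrder_zeroCushioned
  diamondColored := isSpinIso_zeroCushionedEdge.isDiamondColored
  ranked := ⟨_, _, isRankFunction_spinRank⟩
  structured := isSpinIso_zeroCushionedEdge.isStructured
  weightGenFun_eq := isSpinIso_zeroCushionedEdge.weightGenFun_eq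

end ZeroCushionedWords

/-! ### The Mixedmiddleswitch digraph as the spin digraph -/

section BinarySequences

variable {n : ℕ}

/-- The letter of a binary sequence before position `i`; it is `0` at the start. -/
def prevLetter (s : BinarySeq n) (i : Fin n) : Fin 2 :=
  if h : 0 < (i : ℕ) then s ⟨i - 1, by omega⟩ else 0

theorem prevLetter_succ (s : BinarySeq n) {a i : Fin n} (h : (a : ℕ) + 1 = i) :
    prevLetter s i = s a := by
  unfold prevLetter
  rw [dif_pos (by omega)]
  exact congrArg s (Fin.ext (by simp only; omega))

theorem prevLetter_zero (s : BinarySeq n) {i : Fin n} (h : (i : ℕ) = 0) :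
    prevLetter s i = 0 := by
  unfold prevLetter
  rw [dif_neg (by omega)]

/-- The word of changes of a binary sequence. -/
def changeWord (s : BinarySeq n) : SpinWord n := fun i => decide (prevLetter s i ≠ s i)

theorem changeWord_injective : Function.Injective (changeWord (n := n)) := by
  intro s t h
  have key : ∀ (k : ℕ) (i : Fin n), (i : ℕ) = k → s i = t i := by
    intro k
    induction k with
    | zero =>
      intro i hi
      have h1 := congrFun h i
      simp only [changeWord, prevLetter_zero _ hi] at h1
      revert h1
      generalize s i = x
      generalize t i = y
      revert x y
      decide
    | succ k ih =>
      intro i hi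
      have h1 := congrFun h i
      have h2 := ih ⟨k, by omega⟩ rfl
      simp only [changeWord, prevLetter_succ (a := ⟨k, by omega⟩) _ hi.symm, h2] at h1
      revert h1
      generalize s i = x
      generalize t i = y
      generalize t ⟨k, _⟩ = z
      revert x y z
      decide
  exact funext fun i => key i i rfl

/-- Binary sequences correspond to words. -/
noncomputable def changeEquiv (n : ℕ) : BinarySeq n ≃ SpinWord n :=
  Equiv.ofBijective changeWord <| by
    rw [Fintype.bijective_iff_injective_and_card]
    refine ⟨changeWord_injective, ?_⟩
    have : Fintype.card (BinarySeq n) = Fintype.card (Fin n → Fin 2) := rfl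
    rw [this]
    simp

/-- Switch the letter at position `i`. -/
def switchAt (i : Fin n) (s : BinarySeq n) : BinarySeq n := fun j => if j = i then 1 - s i else s j

/-- Switching one letter affects only its comparisons with its two neighbors, recorded at `i` and `i
+ 1`. -/
theorem changeWord_switchAt (i : Fin n) (s : BinarySeq n) :
    changeWord (switchAt i s) = toggle i (changeWord s) := by
  funext j
  by_cases hj : j = i
  · subst hj
    rw [toggle_self]
    have : prevLetter (switchAt j s) j = prevLetter s j := by
      unfold prevLetter switchAt
      split_ifs with h1 h2
      · have := congrArg Fin.val h2; simp only at this; omega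
      · rfl
      · rfl
    simp only [changeWord, this]
    simp only [switchAt, if_true]
    generalize s j = x
    generalize prevLetter s j = y
    revert x y
    decide
  · by_cases hj' : (j : ℕ) = i + 1
    · rw [toggle_next hj']
      simp only [changeWord, prevLetter_succ _ hj'.symm]
      simp only [switchAt, if_true, if_neg hj]
      generalize s j = x
      generalize s i = y
      revert x y
      decide
    · rw [toggle_of_ne hj hj']
      have : prevLetter (switchAt i s) j = prevLetter s j := by
        unfold prevLetter switchAt
        split_ifs with h1 h2
        · have := congrArg Fin.val h2; simp only at this; omega
        · rfl
        · rfl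
      simp only [changeWord, this]
      simp only [switchAt, if_neg hj]

theorem spinEdge_changeWord_iff (s t : BinarySeq n) (i : Fin n) :
    spinEdge (changeWord s) i (changeWord t) ↔
      prevLetter s i = s i ∧ (∀ j : Fin n, (j : ℕ) = i + 1 → s i ≠ s j) ∧ t = switchAt i s := by
  rw [spinEdge, ← changeWord_switchAt, changeWord_injective.eq_iff]
  simp only [changeWord, decide_eq_false_iff_not, decide_eq_true_eq, not_not]
  refine and_congr_right fun _ => and_congr_left fun _ => ?_
  refine forall_congr' fun j => forall_congr' fun hj => ?_
  rw [prevLetter_succ _ hj.symm]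

theorem eq_switchAt_iff (s t : BinarySeq n) (i : Fin n) :
    t = switchAt i s ↔ (∀ j, j ≠ i → s j = t j) ∧ t i = 1 - s i := by
  constructor
  · rintro rfl
    exact ⟨fun j hj => by simp [switchAt, hj], by simp [switchAt]⟩
  · rintro ⟨h1, h2⟩
    funext j
    by_cases hj : j = i
    · subst hj; simp [switchAt, h2]
    · simp [switchAt, hj, h1 j hj]

/-- All five switching rules say the same thing: the letter equals its predecessor, differs from its
successor if there is one, and is switched. The fictitious `0` before the start explains why the
left end has a single rule. As `n ≥ 2`, no position is both first and last. -/
theorem mixedMiddleSwitchEdge_iff (hn : 2 ≤ n) (s t : BinarySeq n) (i : Fin n) :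
    mixedMiddleSwitchEdge n s i t ↔ spinEdge (changeWord s) i (changeWord t) := by
  rw [spinEdge_changeWord_iff, eq_switchAt_iff]
  simp only [mixedMiddleSwitchEdge, Prod.mk.injEq]
  have hnext : ∀ {b : Fin n}, (i : ℕ) + 1 = b → s i ≠ s b →
      ∀ j : Fin n, (j : ℕ) = i + 1 → s i ≠ s j := by
    intro b hb h j hj
    rwa [show j = b from Fin.ext (by omega)]
  constructor
  · rintro ⟨h, ⟨a, b, ha, hb, ⟨h1, h2, h3⟩, -, h4, -⟩ | ⟨a, b, ha, hb, ⟨h1, h2, h3⟩, -, h4, -⟩ |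
      ⟨hi, b, hb, ⟨h2, h3⟩, h4, -⟩ | ⟨hi, a, ha, ⟨h1, h2⟩, -, h4⟩ | ⟨hi, a, ha, ⟨h1, h2⟩, -, h4⟩⟩
    · exact ⟨by rw [prevLetter_succ s ha, h1, h2], hnext hb (by rw [h2, h3]; decide), h,
        by rw [h2, h4]; rfl⟩
    · exact ⟨by rw [prevLetter_succ s ha, h1, h2], hnext hb (by rw [h2, h3]; decide), h,
        by rw [h2, h4]; rfl⟩
    · exact ⟨by rw [prevLetter_zero s hi, h2], hnext hb (by rw [h2, h3]; decide), h,
        by rw [h2, h4]; rfl⟩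
    · exact ⟨by rw [prevLetter_succ s ha, h1, h2], fun j hj => by omega, h,
        by rw [h2, h4]; rfl⟩
    · exact ⟨by rw [prevLetter_succ s ha, h1, h2], fun j hj => by omega, h,
        by rw [h2, h4]; rfl⟩
  · rintro ⟨h1, h2, h, h4⟩
    have two : ∀ x : Fin 2, x = 0 ∨ x = 1 := by decide
    have other : ∀ x y : Fin 2, x ≠ y → y = 1 - x := by decide
    refine ⟨h, ?_⟩
    by_cases hi0 : (i : ℕ) = 0
    · have hb : (i : ℕ) + 1 < n := by omega
      rw [prevLetter_zero s hi0] at h1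
      have h5 := other _ _ (h2 ⟨i + 1, hb⟩ rfl)
      have h6 := h ⟨i + 1, hb⟩ (fun e => by have := congrArg Fin.val e; simp at this)
      refine Or.inr (Or.inr (Or.inl ⟨hi0, ⟨i + 1, hb⟩, rfl, ?_⟩))
      rw [← h6, h5, h4, ← h1]
      decide
    · have ha : (i : ℕ) - 1 < n := by omega
      have ha' : ((⟨i - 1, ha⟩ : Fin n) : ℕ) + 1 = i := by simp only; omega
      rw [prevLetter_succ s ha'] at h1
      have h5 := h ⟨i - 1, ha⟩ (fun e => by have := congrArg Fin.val e; simp only at this; omega)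
      by_cases hin : (i : ℕ) + 1 = n
      · rcases two (s i) with hs | hs
        · refine Or.inr (Or.inr (Or.inr (Or.inl ⟨hin, _, ha', ?_⟩)))
          rw [← h5, h1, h4, hs]
          decide
        · refine Or.inr (Or.inr (Or.inr (Or.inr ⟨hin, _, ha', ?_⟩)))
          rw [← h5, h1, h4, hs]
          decide
      · have hb : (i : ℕ) + 1 < n := by omega
        have h6 := other _ _ (h2 ⟨i + 1, hb⟩ rfl)
        have h7 := h ⟨i + 1, hb⟩ (fun e => by have := congrArg Fin.val e; simp at this)
        rcases two (s i) with hs | hs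
        · refine Or.inl ⟨_, ⟨i + 1, hb⟩, ha', rfl, ?_⟩
          rw [← h5, ← h7, h6, h1, h4, hs]
          decide
        · refine Or.inr (Or.inl ⟨_, ⟨i + 1, hb⟩, ha', rfl, ?_⟩)
          rw [← h5, ← h7, h6, h1, h4, hs]
          decide

theorem isSpinIso_mixedMiddleSwitchEdge (hn : 2 ≤ n) :
    IsSpinIso (mixedMiddleSwitchEdge n) (changeEquiv n) :=
  fun s i t => mixedMiddleSwitchEdge_iff hn s t i

end BinarySequences

/-! ### Transport along order isomorphisms -/

section TransportOfStructure

variable {V V' I : Type*} [PartialOrder V] [PartialOrder V']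

theorem IsOrderDiagram.of_orderIso {E : V → I → V → Prop} {E' : V' → I → V' → Prop} (f : V ≃o V')
    (hf : ∀ s i t, E s i t ↔ E' (f s) i (f t)) (h : IsOrderDiagram E') : IsOrderDiagram E := by
  refine ⟨fun s i t hst => ?_, fun s t hst => ?_⟩
  · rw [← apply_covBy_apply_iff f]
    exact h.1 _ i _ ((hf s i t).1 hst)
  · rw [← apply_covBy_apply_iff f] at hst
    simpa only [hf] using h.2 _ _ hst

theorem IsDistributiveLatticeOrder.of_orderIso (f : V ≃o V')
    (h : IsDistributiveLatticeOrder V') : IsDistributiveLatticeOrder V := by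
  obtain ⟨L, hL⟩ := h
  let L' : Lattice V :=
    { (inferInstance : PartialOrder V) with
      sup := fun a b => f.symm (L.sup (f a) (f b))
      inf := fun a b => f.symm (L.inf (f a) (f b))
      le_sup_left := fun a b => by
        rw [← f.le_iff_le, f.apply_symm_apply, ← hL]; exact L.le_sup_left _ _
      le_sup_right := fun a b => by
        rw [← f.le_iff_le, f.apply_symm_apply, ← hL]; exact L.le_sup_right _ _
      sup_le := fun a b c => by
        rw [← f.le_iff_le, ← f.le_iff_le, ← f.le_iff_le, f.apply_symm_apply, ← hL, ← hL, ← hL]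
        exact L.sup_le _ _ _
      inf_le_left := fun a b => by
        rw [← f.le_iff_le, f.apply_symm_apply, ← hL]; exact L.inf_le_left _ _
      inf_le_right := fun a b => by
        rw [← f.le_iff_le, f.apply_symm_apply, ← hL]; exact L.inf_le_right _ _
      le_inf := fun a b c => by
        rw [← f.le_iff_le, ← f.le_iff_le, ← f.le_iff_le, f.apply_symm_apply, ← hL, ← hL, ← hL]
        exact L.le_inf _ _ _ }
  refine ⟨{ L' with le_sup_inf := fun a b c => ?_ }, fun a b => Iff.rfl⟩
  change f.symm _ ≤ f.symm _
  rw [f.symm.le_iff_le, ← hL]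
  change L.le (L.inf (f (f.symm (L.sup (f a) (f b)))) (f (f.symm (L.sup (f a) (f c)))))
    (L.sup (f a) (f (f.symm (L.inf (f b) (f c)))))
  rw [f.apply_symm_apply, f.apply_symm_apply, f.apply_symm_apply]
  exact L.le_sup_inf _ _ _

theorem IsRankFunction.comp_orderIso (f : V ≃o V') {ρ : V' → ℕ} {l : ℕ} (h : IsRankFunction ρ l) :
    IsRankFunction (ρ ∘ f) l := by
  refine ⟨?_, fun s _ t _ hst => ?_⟩
  · rw [← h.1, Set.image_univ, Set.image_univ, f.surjective.range_comp]
  · exact h.2 _ (Set.mem_univ _) _ (Set.mem_univ _) ((apply_covBy_apply_iff f).2 hst)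

end TransportOfStructure

/-- The order is pulled back from `𝒵(n)` through words; both encodings turn colored edges into spin
edges, so the order diagram is the prescribed one. -/
theorem exists_partialOrder_isSplitting_binarySeq {n : ℕ} (hn : 2 ≤ n) :
    ∃ _ : PartialOrder (BinarySeq n),
      IsDiamondColoredSplittingDistributiveLattice (CartanMatrix.B n)
        (mixedMiddleSwitchEdge n) (spinCharacter n) := by
  let e : BinarySeq n ≃ ZeroCushioned n := (changeEquiv n).trans (wordEquiv n).symm
  let P : PartialOrder (BinarySeq n) := PartialOrder.lift e e.injective
  let f : BinarySeq n ≃o ZeroCushioned n := ⟨e, Iff.rfl⟩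
  have hiso := isSpinIso_mixedMiddleSwitchEdge hn
  have hf : ∀ s i t, mixedMiddleSwitchEdge n s i t ↔ zeroCushionedEdge n (f s) i (f t) := by
    intro s i t
    rw [hiso, isSpinIso_zeroCushionedEdge]
    change _ ↔ spinEdge (wordEquiv n ((wordEquiv n).symm (changeEquiv n s))) i
      (wordEquiv n ((wordEquiv n).symm (changeEquiv n t)))
    rw [Equiv.apply_symm_apply, Equiv.apply_symm_apply]
  exact ⟨P,
    { orderDiagram := isOrderDiagram_zeroCushionedEdge.of_orderIso f hf
      distributive := isDistributiveLatticeOrder_zeroCushioned.of_orderIso f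
      diamondColored := hiso.isDiamondColored
      ranked := ⟨_, _, isRankFunction_spinRank.comp_orderIso f⟩
      structured := hiso.isStructured
      weightGenFun_eq := hiso.weightGenFun_eq }⟩

end SplittingPosets

open SplittingPosets
theorem proposition3p3 (n : ℕ) (hn : 2 ≤ n) :
    ∃ χ : AddMonoidAlgebra ℤ (Fin n → ℤ),
      IsWeylBialternant (CartanMatrix.B n)
        (fundamentalWeight (⟨n - 1, by omega⟩ : Fin n)) χ ∧
      IsDiamondColoredSplittingDistributiveLattice (CartanMatrix.B n) (zeroCushionedEdge n) χ ∧
      (∀ (ρ : ZeroCushioned n → ℕ) (l : ℕ), IsRankFunction ρ l →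
        rankGenFun ρ = ∏ i ∈ Finset.Icc 1 n, (1 + X ^ i) ∧
        IsSymmetricPoly (rankGenFun ρ) ∧ IsUnimodalPoly (rankGenFun ρ)) ∧
      ∃ _ : PartialOrder (BinarySeq n),
        IsDiamondColoredSplittingDistributiveLattice (CartanMatrix.B n)
          (mixedMiddleSwitchEdge n) χ := by
  refine ⟨spinCharacter n, isWeylBialternant_spinCharacter _ (by simp only; omega),
    isSplitting_zeroCushioned, fun ρ l h => ?_, exists_partialOrder_isSplitting_binarySeq hn⟩
  rw [rankGenFun_of_isRankFunction h]
  exact ⟨rankGenFun_spinRank_eq_prod, isSymmetricPoly_rankGenFun_spinRank,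
    isUnimodalPoly_rankGenFun_spinRank⟩
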